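/- For $\lambda\in\mathbb{R}\setminus\{0\}$ and $f\in L^1(\mathbb{R}^2)\cap L^2(\mathbb{R}^2)$ let $$K^\lambda_f(\xi,\eta)=\int_{\mathbb{R}} f(x,\eta-\xi)\,e^{\pi i\lambda x(\xi+\eta)}\,dx ,$$ and let $f\mapsto K^\lambda_f$ also denote the continuous extension of this map to $L^2(\mathbb{R}^2)\to L^2(\mathbb{R}^2)$; write $K_f=K^1_f$. For $\varphi\in L^2(\mathbb{R}^2)$, $j,k,l\in\mathbb{Z}$ and $a,b,\lambda\in\mathbb{R}$ put $$(T^t_{(k,l)})^\lambda\varphi(x,y)=e^{\pi i\lambda(xl-yk)}\varphi(x-k,y-l),\qquad \mathcal{D}_{2^j}\varphi(x,y)=2^j\varphi(2^jx,2^jy),\qquad (e(a,b)\varphi)(x,y)=e^{2\pi i(ax+by)}\varphi(x,y).$$ Theorem. Let $\varphi\in L^2(\mathbb{R}^2)$. For $\xi\in[0,1]$, $j,j_1,j_2,l,l_1,l_2,m\in\mathbb{Z}$ and $y\in\mathbb{R}$ let $$P^\varphi_{j_1,j_2,l_1,l_2}(\xi)=\sum_{m\in\mathbb{Z}}\int_{\mathbb{R}}K_\varphi^{2^{-2j_1}}\big(2^{j_1+j_2}(\xi+m)+l_1,\,2^{j_1}\eta\big)\,\overline{K_\varphi^{2^{-2j_2}}\big(2^{2j_2}(\xi+m)+l_2,\,2^{j_2}\eta\big)}\,d\eta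 ,$$ and, for $j\neq 0$, $$S^{\varphi}_{j,l}(\xi,m,y)=K_{e\left(\frac{2^{-2j}-1}{2}l,\,0\right)\varphi}\left(\frac{2(\xi+m-y)}{1+2^{-2j}}+l,\ \frac{2y}{1-2^{-2j}}\right),$$ $$R^\varphi_{j,l}(\xi)=\sum_{m\in\mathbb{Z}}\int_{\mathbb{R}}|S^{\varphi}_{j,l}(\xi,m,y)|^2\,dy,\qquad Q^\varphi_{j,l_1,l_2}(\xi)=\sum_{m\in\mathbb{Z}}\int_{\mathbb{R}}S^{\varphi}_{j,l_1}(\xi,m,y)\,\overline{S^{\varphi}_{j,l_2}(\xi,m,y)}\,dy .$$ Then the twisted wavelet system $\{\mathcal{D}_{2^j}(T^t_{(k,l)})^{2^{-2j}}\varphi : j,k,l\in\mathbb{Z}\}$ is orthonormal in $L^2(\mathbb{R}^2)$ if and only if all of the following hold: (i) $\sum_{m\in\mathbb{Z}}\int_{\mathbb{R}}|K_\varphi(\xi+m,\eta)|^2\,d\eta=1$ for a.e. $\xi\in[0,1]$; (ii) for every $l\in\mathbb{Z}\setminus\{0\}$, $\sum_{m\in\mathbb{Z}}\int_{\mathbb{R}}K_\varphi(\xi+m,\eta)\,\overline{K_\varphi(\xi+m+l,\eta)}\,d\eta=0$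 for a.e. $\xi\in[0,1]$; (iii) for all $j_1,j_2,l_1,l_2\in\mathbb{Z}$ with $j_2>j_1$, $P^\varphi_{j_1,j_2,l_1,l_2}(\xi)=0$ for a.e. $\xi\in[0,1]$; (iv) for all $j\in\mathbb{Z}\setminus\{0\}$ and $l_1\neq l_2$ in $\mathbb{Z}$, $Q^\varphi_{j,l_1,l_2}(\xi)=0$ for a.e. $\xi\in[0,1]$; (v) for all $j\in\mathbb{Z}\setminus\{0\}$ and $l\in\mathbb{Z}$, $R^\varphi_{j,l}(\xi)=\tfrac{|1-2^{-4j}|}{4}$ for a.e. $\xi\in[0,1]$. -/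

import Mathlib

noncomputable section
namespace TwistedWavelet
open MeasureTheory Complex FourierTransform
open scoped Real ENNReal ContDiff

/-- The complex Hilbert space `L²(ℝ²)` for Lebesgue measure. -/
abbrev L2Plane : Type := Lp ℂ 2 (volume : Measure (ℝ × ℝ))

/-- Plancherel's identity for the Fourier integral on `L¹(ℝ) ∩ L²(ℝ)`. -/
theorem lintegral_fourier_sq {g : ℝ → ℂ} (h1 : Integrable g) (h2 : MemLp g 2) :
    ∫⁻ t, ‖𝓕 g t‖ₑ ^ 2 = ∫⁻ x, ‖g x‖ₑ ^ 2 := by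
  set G : Lp ℂ 2 (volume : Measure ℝ) := h2.toLp g with hG
  have hcont : Continuous (𝓕 g) :=
    VectorFourier.fourierIntegral_continuous Real.continuous_fourierChar
      (by exact continuous_inner) h1
  have key : ∀ᵐ t : ℝ, (𝓕 G : Lp ℂ 2 (volume : Measure ℝ)) t = 𝓕 g t := by
    refine ae_eq_of_integral_contDiff_smul_eq ?_ hcont.locallyIntegrable ?_
    · exact (Lp.memLp (𝓕 G)).locallyIntegrable (by norm_num)
    intro u hu hus
    have hu' : ContDiff ℝ ∞ (fun x => (u x : ℂ)) := Complex.ofRealCLM.contDiff.comp hu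
    have hus' : HasCompactSupport (fun x => (u x : ℂ)) := hus.comp_left (g := fun x : ℝ => (x : ℂ)) (by simp)
    set U : SchwartzMap ℝ ℂ := hus'.toSchwartzMap hu' with hU
    have hUx : ∀ x, U x = u x := fun x => rfl
    have e1 := congrArg (fun T : TemperedDistribution ℝ ℂ => T U) (Lp.fourier_toTemperedDistribution_eq G)
    simp only [TemperedDistribution.fourier_apply, Lp.toTemperedDistribution_apply] at e1
    have e2 : ∫ x, (𝓕 U) x • G x = ∫ x, (𝓕 (U : ℝ → ℂ)) x • g x := by
      apply integral_congr_ae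
      filter_upwards [h2.coeFn_toLp] with x hx
      rw [hG, hx, SchwartzMap.fourier_coe]
    have e3 : ∫ x, (𝓕 (U : ℝ → ℂ)) x • g x = ∫ x, U x • 𝓕 g x := by
      have := VectorFourier.integral_fourierIntegral_smul_eq_flip (μ := volume) (ν := volume)
        (L := innerₗ ℝ) Real.continuous_fourierChar (by exact continuous_inner) U.integrable h1
      rwa [flip_innerₗ] at this
    have e4 : ∀ x, ∀ z : ℂ, u x • z = U x • z := fun x z => by simp [hUx]
    simp_rw [e4]
    rw [← e1, e2, e3]
  have n1 := Lp.norm_fourier_eq G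
  have n2 : eLpNorm (𝓕 G : Lp ℂ 2 (volume : Measure ℝ)) 2 volume = eLpNorm G 2 volume := by
    rw [← Lp.enorm_def, ← Lp.enorm_def]
    simp only [← ofReal_norm, n1]
  rw [eLpNorm_congr_ae key, eLpNorm_congr_ae h2.coeFn_toLp] at n2
  have p1 := eLpNorm_nnreal_pow_eq_lintegral (f := 𝓕 g) (μ := volume) (p := 2) (by norm_num)
  have p2 := eLpNorm_nnreal_pow_eq_lintegral (f := g) (μ := volume) (p := 2) (by norm_num)
  have : ∀ z : ℝ≥0∞, z ^ (((2 : NNReal) : ℝ)) = z ^ 2 := fun z => by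
    rw [← ENNReal.rpow_natCast]; norm_num
  simp only [this] at p1 p2
  rw [← p1, ← p2]
  exact congrArg (· ^ 2) n2

theorem eLpNorm_comp_linear (L : ℝ × ℝ →ₗ[ℝ] ℝ × ℝ) (hL : LinearMap.det L ≠ 0)
    {f : ℝ × ℝ → ℂ} (hf : AEStronglyMeasurable f) :
    AEStronglyMeasurable (fun p => f (L p)) ∧
      eLpNorm (fun p => f (L p)) 2 volume =
        ENNReal.ofReal |(LinearMap.det L)⁻¹| ^ (1 / 2 : ℝ) * eLpNorm f 2 volume := by
  have hm := Measure.map_linearMap_addHaar_eq_smul_addHaar (volume : Measure (ℝ × ℝ)) hL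
  have hLc : Measurable L := (LinearMap.continuous_of_finiteDimensional L).measurable
  have hf' : AEStronglyMeasurable f (Measure.map L volume) := by
    rw [hm]; exact hf.smul_measure _
  refine ⟨hf'.comp_measurable hLc, ?_⟩
  have := eLpNorm_map_measure (p := 2) hf' hLc.aemeasurable
  rw [hm, eLpNorm_smul_measure_of_ne_top (by norm_num)] at this
  simpa [Function.comp_def] using this.symm

/-- The integral `∫ f(x, η - ξ) exp(πiλx(ξ + η)) dx`, as a function of `p = (ξ, η)`. -/
def kernelIntegral (lam : ℝ) (f : ℝ × ℝ → ℂ) (p : ℝ × ℝ) : ℂ :=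
  ∫ x : ℝ, f (x, p.2 - p.1) * cexp (π * I * lam * x * (p.1 + p.2))

/-- The Fourier transform of `f` in its first variable. -/
def partialFourier (f : ℝ × ℝ → ℂ) (q : ℝ × ℝ) : ℂ :=
  𝓕 (fun x => f (x, q.2)) q.1

theorem aestronglyMeasurable_partialFourier {f : ℝ × ℝ → ℂ} (h1 : AEStronglyMeasurable f) :
    AEStronglyMeasurable (partialFourier f) := by
  have hF : AEStronglyMeasurable (fun z : (ℝ × ℝ) × ℝ => f (z.2, z.1.2))
      ((volume : Measure (ℝ × ℝ)).prod volume) := by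
    have a1 : AEStronglyMeasurable (fun w : ℝ × ℝ => f w.swap)
      ((volume : Measure ℝ).prod volume) := AEStronglyMeasurable.prod_swap h1
    have a2 : AEStronglyMeasurable (fun w : ℝ × (ℝ × ℝ) => f w.2.swap)
      ((volume : Measure ℝ).prod ((volume : Measure ℝ).prod volume)) := a1.comp_snd
    exact a2.comp_measurePreserving
      (measurePreserving_prodAssoc (volume : Measure ℝ) (volume : Measure ℝ) (volume : Measure ℝ))
  have hE : Continuous (fun z : (ℝ × ℝ) × ℝ => cexp (↑(-2 * π * inner ℝ z.2 z.1.1) * I)) := by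
    fun_prop
  have := (hE.aestronglyMeasurable.smul hF).integral_prod_right'
  refine this.congr (Filter.Eventually.of_forall fun q => ?_)
  simp only [partialFourier, Real.fourier_eq']
  rfl

theorem lintegral_partialFourier_sq {f : ℝ × ℝ → ℂ} (h1 : Integrable f) (h2 : MemLp f 2) :
    ∫⁻ q, ‖partialFourier f q‖ₑ ^ 2 = ∫⁻ p, ‖f p‖ₑ ^ 2 := by
  have hm := aestronglyMeasurable_partialFourier h1.aestronglyMeasurable
  rw [Measure.volume_eq_prod] at hm h1 h2 ⊢
  rw [lintegral_prod_symm _ (hm.enorm.pow_const 2), lintegral_prod_symm _ (h2.1.enorm.pow_const 2)]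
  have i2 : Integrable (fun p => ‖f p‖ ^ 2) ((volume : Measure ℝ).prod volume) :=
    (memLp_two_iff_integrable_sq_norm h2.1).1 h2
  refine lintegral_congr_ae ?_
  filter_upwards [h1.prod_left_ae, i2.prod_left_ae] with y hy1 hy2
  change ∫⁻ t, ‖𝓕 (fun x => f (x, y)) t‖ₑ ^ 2 = _
  exact lintegral_fourier_sq hy1
    ((memLp_two_iff_integrable_sq_norm hy1.aestronglyMeasurable).2 hy2)

theorem eLpNorm_kernelIntegral {lam : ℝ} (hlam : lam ≠ 0) {f : ℝ × ℝ → ℂ}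
    (h1 : Integrable f) (h2 : MemLp f 2) :
    AEStronglyMeasurable (kernelIntegral lam f) ∧
      eLpNorm (kernelIntegral lam f) 2 volume =
        ENNReal.ofReal |lam⁻¹| ^ (1 / 2 : ℝ) * eLpNorm f 2 volume := by
  let L : ℝ × ℝ →ₗ[ℝ] ℝ × ℝ :=
    LinearMap.prod ((-lam / 2) • (LinearMap.fst ℝ ℝ ℝ + LinearMap.snd ℝ ℝ ℝ))
      (LinearMap.snd ℝ ℝ ℝ - LinearMap.fst ℝ ℝ ℝ)
  have hdet : LinearMap.det L = -lam := by
    rw [← LinearMap.det_toMatrix (Module.Basis.finTwoProd ℝ), Matrix.det_fin_two]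
    simp [LinearMap.toMatrix_apply, L]
  have hK : kernelIntegral lam f = fun p => partialFourier f (L p) := by
    funext p
    simp only [kernelIntegral, partialFourier, L, Real.fourier_eq']
    congr 1
    funext x
    simp [mul_comm (f _)]
    left
    congr 1
    ring
  have hs : ∀ u : ℝ × ℝ → ℂ, eLpNorm u 2 volume = (∫⁻ z, ‖u z‖ₑ ^ 2) ^ (1 / 2 : ℝ) := by
    intro u
    rw [eLpNorm_eq_lintegral_rpow_enorm_toReal (by norm_num) (by norm_num)]
    norm_num
  have hn : eLpNorm f 2 volume = eLpNorm (partialFourier f) 2 volume := by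
    rw [hs, hs, lintegral_partialFourier_sq h1 h2]
  have hl := eLpNorm_comp_linear L (by rw [hdet]; exact neg_ne_zero.2 hlam)
    (aestronglyMeasurable_partialFourier h1.aestronglyMeasurable)
  rw [hdet, inv_neg, abs_neg] at hl
  rw [hK, hn]
  exact hl

theorem memLp_kernelIntegral {lam : ℝ} (hlam : lam ≠ 0) {f : ℝ × ℝ → ℂ}
    (h1 : Integrable f) (h2 : MemLp f 2) : MemLp (kernelIntegral lam f) 2 := by
  obtain ⟨hm, he⟩ := eLpNorm_kernelIntegral hlam h1 h2
  refine ⟨hm, ?_⟩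
  rw [he]
  exact ENNReal.mul_lt_top (ENNReal.rpow_lt_top_of_nonneg (by norm_num) ENNReal.ofReal_ne_top) h2.2

/-- The subspace `L¹(ℝ²) ∩ L²(ℝ²)` of `L²(ℝ²)`. -/
def integrableL2 : Submodule ℂ L2Plane where
  carrier := {f | Integrable f volume}
  add_mem' {f g} hf hg := by
    have h : Integrable (⇑f + ⇑g) volume := Integrable.add hf hg
    exact h.congr (Lp.coeFn_add f g).symm
  zero_mem' := by
    have h : Integrable (0 : ℝ × ℝ → ℂ) volume := integrable_zero _ _ _
    exact h.congr (Lp.coeFn_zero ℂ 2 volume).symm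
  smul_mem' c f hf := by
    have h : Integrable (c • ⇑f) volume := Integrable.smul c hf
    exact h.congr (Lp.coeFn_smul c f).symm

theorem kernelIntegral_ae_linear (lam : ℝ) (a b : ℂ) {f g h : ℝ × ℝ → ℂ} (hf : Integrable f)
    (hg : Integrable g) (hh : ∀ᵐ p : ℝ × ℝ, h p = a * f p + b * g p) :
    ∀ᵐ p : ℝ × ℝ, kernelIntegral lam h p =
      a * kernelIntegral lam f p + b * kernelIntegral lam g p := by
  have hh' : ∀ᵐ y : ℝ, ∀ᵐ x : ℝ, h (x, y) = a * f (x, y) + b * g (x, y) :=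
    Measure.ae_ae_of_ae_prod ((Measure.measurePreserving_swap (μ := (volume : Measure ℝ))
      (ν := (volume : Measure ℝ))).quasiMeasurePreserving.ae hh)
  have hq := (Measure.quasiMeasurePreserving_snd (μ := (volume : Measure ℝ))
    (ν := (volume : Measure ℝ))).comp
      (measurePreserving_prod_sub (volume : Measure ℝ) (volume : Measure ℝ)).quasiMeasurePreserving
  have hf' : ∀ᵐ y : ℝ, Integrable (fun x => f (x, y)) := hf.prod_left_ae
  have hg' : ∀ᵐ y : ℝ, Integrable (fun x => g (x, y)) := hg.prod_left_ae
  have hc : ∀ p : ℝ × ℝ, ∀ u : ℝ → ℂ, Integrable u →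
      Integrable (fun x : ℝ => u x * cexp (π * I * lam * x * (p.1 + p.2))) := by
    intro p u hu
    refine hu.mul_bdd (c := 1) (by fun_prop) (Filter.Eventually.of_forall fun x => ?_)
    have : (π * I * lam * x * (p.1 + p.2) : ℂ) = ((π * lam * x * (p.1 + p.2) : ℝ) : ℂ) * I := by
      push_cast; ring
    rw [this, Complex.norm_exp_ofReal_mul_I]
  filter_upwards [hq.ae hh', hq.ae hf', hq.ae hg'] with p h1 h2 h3
  have h1' : ∀ᵐ x : ℝ, h (x, p.2 - p.1) = a * f (x, p.2 - p.1) + b * g (x, p.2 - p.1) := h1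
  have h2' : Integrable (fun x => f (x, p.2 - p.1)) := h2
  have h3' : Integrable (fun x => g (x, p.2 - p.1)) := h3
  simp only [kernelIntegral]
  rw [← integral_const_mul, ← integral_const_mul,
    ← integral_add ((hc p _ h2').const_mul a) ((hc p _ h3').const_mul b)]
  refine integral_congr_ae ?_
  filter_upwards [h1'] with x hx
  rw [hx]
  ring

/-- The map `f ↦ K^λ_f`, given by the kernel integral, on `L¹(ℝ²) ∩ L²(ℝ²)`. -/
def weylKernelOnL1 (lam : ℝ) (hlam : lam ≠ 0) : integrableL2 →ₗ[ℂ] L2Plane where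
  toFun f := (memLp_kernelIntegral hlam f.2 (Lp.memLp f.1)).toLp (kernelIntegral lam f.1)
  map_add' f g := by
    rw [← MemLp.toLp_add, MemLp.toLp_eq_toLp_iff]
    filter_upwards [kernelIntegral_ae_linear lam 1 1 (h := (f + g).1) f.2 g.2 (by
      filter_upwards [Lp.coeFn_add f.1 g.1] with p hp
      simpa using hp)] with p hp
    simpa using hp
  map_smul' c f := by
    rw [← MemLp.toLp_const_smul, MemLp.toLp_eq_toLp_iff]
    filter_upwards [kernelIntegral_ae_linear lam c 0 (h := (c • f).1) f.2 f.2 (by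
      filter_upwards [Lp.coeFn_smul c f.1] with p hp
      simpa using hp)] with p hp
    simpa using hp

theorem norm_weylKernelOnL1 (lam : ℝ) (hlam : lam ≠ 0) (f : integrableL2) :
    ‖weylKernelOnL1 lam hlam f‖ = |lam⁻¹| ^ (1 / 2 : ℝ) * ‖f.1‖ := by
  have h := (eLpNorm_kernelIntegral hlam f.2 (Lp.memLp f.1)).2
  change ‖(memLp_kernelIntegral hlam f.2 (Lp.memLp f.1)).toLp _‖ = _
  rw [Lp.norm_toLp, h, ENNReal.toReal_mul, ← Lp.norm_def, ← ENNReal.toReal_rpow,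
    ENNReal.toReal_ofReal (abs_nonneg _)]

theorem dense_integrableL2 : DenseRange integrableL2.subtype := by
  have h := Lp.simpleFunc.dense (E := ℂ) (p := 2) (μ := (volume : Measure (ℝ × ℝ))) (by norm_num)
  have : (Lp.simpleFunc ℂ 2 (volume : Measure (ℝ × ℝ)) : Set L2Plane) ⊆
      Set.range integrableL2.subtype := by
    intro f hf
    have hs := SimpleFunc.memLp_iff_integrable (μ := (volume : Measure (ℝ × ℝ))) (p := 2)
      (f := Lp.simpleFunc.toSimpleFunc ⟨f, hf⟩) (by norm_num) (by norm_num)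
    have hi := hs.1 (Lp.simpleFunc.memLp ⟨f, hf⟩)
    exact ⟨⟨f, hi.congr (Lp.simpleFunc.toSimpleFunc_eq_toFun ⟨f, hf⟩)⟩, rfl⟩
  exact h.mono this

/-- The kernel `K^λ_φ` of the operator `W_λ(φ)` for `φ ∈ L²(ℝ²)` and `λ ≠ 0`: the continuous
extension to `L²(ℝ²)` of the kernel integral on the dense subspace `L¹(ℝ²) ∩ L²(ℝ²)`.
(The value at `λ = 0` is a convention and is never used.) -/
def weylKernel (lam : ℝ) : L2Plane →L[ℂ] L2Plane :=
  if h : lam = 0 then 0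
  else (weylKernelOnL1 lam h).extendOfNorm integrableL2.subtype

/-- On `L¹(ℝ²) ∩ L²(ℝ²)` the kernel is given by the integral formula. -/
theorem weylKernel_of_integrable {lam : ℝ} (hlam : lam ≠ 0) {f : L2Plane}
    (hf : Integrable f volume) : weylKernel lam f =ᵐ[volume] kernelIntegral lam f := by
  have h : weylKernel lam f = weylKernelOnL1 lam hlam ⟨f, hf⟩ := by
    rw [weylKernel, dif_neg hlam]
    exact LinearMap.extendOfNorm_eq (e := integrableL2.subtype) dense_integrableL2
      ⟨_, fun x => (norm_weylKernelOnL1 lam hlam x).le⟩ ⟨f, hf⟩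
  rw [h]
  exact MemLp.coeFn_toLp (memLp_kernelIntegral hlam hf (Lp.memLp f))

/-- Multiplying an `L²` function by a continuous unimodular function. -/
theorem memLp_phase_mul {θ : ℝ × ℝ → ℝ} (hθ : Continuous θ) {f : ℝ × ℝ → ℂ} (hf : MemLp f 2) :
    MemLp (fun p => cexp (θ p * I) * f p) 2 := by
  refine hf.of_le (by
    have : Continuous fun p => cexp (θ p * I) := by fun_prop
    exact this.aestronglyMeasurable.mul hf.1) (Filter.Eventually.of_forall fun p => ?_)
  rw [norm_mul, Complex.norm_exp_ofReal_mul_I, one_mul]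

/-- The operator `e(a,b)`: `(e(a,b)φ)(x,y) = exp(2πi(ax+by)) φ(x,y)`. -/
def modulation (a b : ℝ) (φ : L2Plane) : L2Plane :=
  (memLp_phase_mul (θ := fun p => 2 * π * (a * p.1 + b * p.2)) (by fun_prop)
    (Lp.memLp φ)).toLp
      (fun p => cexp (((2 * π * (a * p.1 + b * p.2) : ℝ) : ℂ) * I) * φ p)

theorem memLp_translate (v : ℝ × ℝ) (φ : L2Plane) : MemLp (fun p => φ (p - v)) 2 :=
  (Lp.memLp φ).comp_measurePreserving (measurePreserving_sub_right volume v)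

/-- The `λ`-twisted translation:
`((T^t_{(k,l)})^λ φ)(x,y) = exp(πiλ(xl-yk)) φ(x-k,y-l)`. -/
def twistedTranslation (lam : ℝ) (k l : ℤ) (φ : L2Plane) : L2Plane :=
  (memLp_phase_mul (θ := fun p => π * lam * (p.1 * l - p.2 * k)) (by fun_prop)
    (memLp_translate ((k : ℝ), (l : ℝ)) φ)).toLp
      (fun p => cexp (((π * lam * (p.1 * l - p.2 * k) : ℝ) : ℂ) * I) * φ (p - ((k : ℝ), (l : ℝ))))

theorem memLp_dilate {a : ℝ} (ha : a ≠ 0) (φ : L2Plane) :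
    MemLp (fun p : ℝ × ℝ => (a : ℂ) * φ (a * p.1, a * p.2)) 2 := by
  have hd : LinearMap.det (a • (LinearMap.id : ℝ × ℝ →ₗ[ℝ] ℝ × ℝ)) ≠ 0 := by
    simp [LinearMap.det_smul, ha]
  obtain ⟨hm, he⟩ := eLpNorm_comp_linear _ hd (Lp.memLp φ).1
  have : MemLp (fun p : ℝ × ℝ => φ (a * p.1, a * p.2)) 2 := by
    refine ⟨hm, ?_⟩
    refine lt_of_eq_of_lt he (ENNReal.mul_lt_top
      (ENNReal.rpow_lt_top_of_nonneg (by norm_num) ENNReal.ofReal_ne_top) (Lp.memLp φ).2)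
  exact this.const_mul _

/-- The dilation `(𝒟_{2^j} φ)(x,y) = 2^j φ(2^j x, 2^j y)`. -/
def dilation (j : ℤ) (φ : L2Plane) : L2Plane :=
  (memLp_dilate (a := (2 : ℝ) ^ j) (by positivity) φ).toLp
    (fun p : ℝ × ℝ => (((2 : ℝ) ^ j : ℝ) : ℂ) * φ ((2 : ℝ) ^ j * p.1, (2 : ℝ) ^ j * p.2))

/-- The twisted wavelet system `𝒟_{2^j} (T^t_{(k,l)})^{2^{-2j}} φ`, indexed by `(j, k, l) ∈ ℤ³`. -/
def twistedWavelet (φ : L2Plane) (i : ℤ × ℤ × ℤ) : L2Plane :=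
  dilation i.1 (twistedTranslation ((2 : ℝ) ^ (-2 * i.1)) i.2.1 i.2.2 φ)

/-- `P^φ_{j₁,j₂,l₁,l₂}(ξ)`. -/
def crossP (φ : L2Plane) (j₁ j₂ l₁ l₂ : ℤ) (ξ : ℝ) : ℂ :=
  ∑' m : ℤ, ∫ η : ℝ,
    weylKernel ((2 : ℝ) ^ (-2 * j₁)) φ
        ((2 : ℝ) ^ (j₁ + j₂) * (ξ + m) + l₁, (2 : ℝ) ^ j₁ * η) *
      starRingEnd ℂ (weylKernel ((2 : ℝ) ^ (-2 * j₂)) φ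
        ((2 : ℝ) ^ (2 * j₂) * (ξ + m) + l₂, (2 : ℝ) ^ j₂ * η))

/-- `S^φ_{j,l}(ξ,m,y)`. -/
def kernelS (φ : L2Plane) (j l : ℤ) (ξ : ℝ) (m : ℤ) (y : ℝ) : ℂ :=
  weylKernel 1 (modulation (((2 : ℝ) ^ (-2 * j) - 1) / 2 * l) 0 φ)
    (2 * (ξ + m - y) / (1 + (2 : ℝ) ^ (-2 * j)) + l, 2 * y / (1 - (2 : ℝ) ^ (-2 * j)))

/-- `R^φ_{j,l}(ξ)`. -/
def sumR (φ : L2Plane) (j l : ℤ) (ξ : ℝ) : ℝ :=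
  ∑' m : ℤ, ∫ y : ℝ, ‖kernelS φ j l ξ m y‖ ^ 2

/-- `Q^φ_{j,l₁,l₂}(ξ)`. -/
def sumQ (φ : L2Plane) (j l₁ l₂ : ℤ) (ξ : ℝ) : ℂ :=
  ∑' m : ℤ, ∫ y : ℝ, kernelS φ j l₁ ξ m y * starRingEnd ℂ (kernelS φ j l₂ ξ m y)

end TwistedWavelet
end

open MeasureTheory TwistedWavelet

noncomputable section
namespace TwistedWavelet
open MeasureTheory Complex FourierTransform
open scoped Real ENNReal ContDiff

/-! ### Fourier uniqueness and periodization on the line -/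

/-! The map `f ↦ weylKernel 1 f` is an isometry of `L²(ℝ²)`, so every Gram entry of the system can
be computed on kernels. There a wavelet becomes explicit: the index `k` enters only through a
unimodular phase whose exponent is affine, while `j` and `l` rescale and shift the kernel of `φ`
(`weylKernel_twistedWavelet`, `weylKernel_twistedTranslation`).

After a linear change of variables that turns this phase into `exp(2πinξ)`, with `n` an integer, a
Gram entry is a nonzero constant times a unimodular number times `∫∫ exp(2πinξ) G(ξ,η) dη dξ`, where
`G` is a product of two kernels and does not involve `k`. This integral is the Fourier coefficient,
up to the sign of the index, of the 1-periodic function `∑ₘ ∫ G(ξ+m,η) dη`. Letting the `k`'s vary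
reaches every `n`, so by uniqueness of Fourier coefficients in `L¹` the Gram entries have the
required values exactly when the periodization is a.e. a prescribed constant
(`periodization_fst_ae_eq_const_iff`).

Three substitutions give the five conditions. For scales `j₁ < j₂`, stretching the first variable by
`2^j₂` gives `n = k₁2^(j₂-j₁) - k₂` and condition (iii). For `j = 0` no substitution is needed, and
(i), (ii) result. For one scale `j ≠ 0` the dilation is removed by unitarity; the phase then
involves both variables, and the shear straightening it has Jacobian `4/|1-2^(-4j)|` in absolute
value, the source of the constant in (v); its off-diagonal counterpart is (iv). -/

theorem ae_eq_zero_of_fourierCoeff_eq_zero {h : ℝ → ℂ} (hh : IntegrableOn h (Set.Ioc 0 1))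
    (hz : ∀ n : ℤ, ∫ ξ in Set.Ioc (0 : ℝ) 1, cexp (2 * π * I * n * ξ) * h ξ = 0) :
    ∀ᵐ ξ ∂(volume.restrict (Set.Ioc (0 : ℝ) 1)), h ξ = 0 := by
  have hint : ∀ u : C(UnitAddCircle, ℂ),
      IntegrableOn (fun ξ : ℝ => u ξ * h ξ) (Set.Ioc 0 1) := fun u =>
    Integrable.bdd_mul (c := ‖u‖) hh
      (u.continuous.comp (AddCircle.continuous_mk' 1)).aestronglyMeasurable
      (Filter.Eventually.of_forall fun ξ => u.norm_coe_le_norm _)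
  -- Since `h` is merely integrable, the `L²` Fourier basis does not apply directly. Pairing with
  -- `h` is instead a bounded functional on continuous functions on the circle; it kills the
  -- trigonometric polynomials, which are uniformly dense, hence it is zero.
  let Λ : C(UnitAddCircle, ℂ) →L[ℂ] ℂ := LinearMap.mkContinuous
    { toFun := fun u => ∫ ξ in Set.Ioc (0 : ℝ) 1, u ξ * h ξ
      map_add' := fun u v => by
        rw [← integral_add (hint u) (hint v)]
        simp only [ContinuousMap.add_apply, add_mul]
      map_smul' := fun c u => by
        simp only [ContinuousMap.smul_apply, smul_eq_mul, RingHom.id_apply, mul_assoc]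
        exact integral_const_mul _ _ }
    (∫ ξ in Set.Ioc (0 : ℝ) 1, ‖h ξ‖) (fun u => by
      refine (norm_integral_le_integral_norm _).trans ?_
      rw [mul_comm, ← integral_const_mul]
      refine integral_mono (hint u).norm (hh.norm.const_mul _) fun ξ => ?_
      simp only [norm_mul]
      exact mul_le_mul_of_nonneg_right (u.norm_coe_le_norm _) (norm_nonneg _))
  have hΛ : ∀ u, Λ u = ∫ ξ in Set.Ioc (0 : ℝ) 1, u ξ * h ξ := fun u => rfl
  have hspan : Submodule.span ℂ (Set.range (@fourier 1)) ≤ LinearMap.ker Λ.toLinearMap := by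
    rw [Submodule.span_le]
    rintro _ ⟨n, rfl⟩
    change Λ (fourier n) = 0
    rw [hΛ, ← hz n]
    simp only [fourier_coe_apply, ofReal_one, div_one]
  have htop : ∀ u, Λ u = 0 := fun u => by
    have := Submodule.topologicalClosure_minimal _ hspan Λ.isClosed_ker
    rw [span_fourier_closure_eq_top] at this
    exact this (Submodule.mem_top (x := u))
  have hopen : ∀ᵐ ξ : ℝ, ξ ∈ Set.Ioo (0 : ℝ) 1 → h ξ = 0 := by
    refine isOpen_Ioo.ae_eq_zero_of_integral_contDiff_smul_eq_zero
      (hh.mono_set Set.Ioo_subset_Ioc_self).locallyIntegrableOn fun g hg _ hgs => ?_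
    have hg0 : ∀ x, x ∉ Set.Ioo (0 : ℝ) 1 → g x = 0 := fun x hx => by
      by_contra hne
      exact hx (hgs (subset_tsupport g hne))
    -- A test function supported in the open interval vanishes at both endpoints, so it glues to a
    -- continuous function on the circle.
    have hcont : Continuous (AddCircle.liftIoc (1 : ℝ) 0 fun x => (g x : ℂ)) := by
      refine AddCircle.liftIoc_continuous ?_ ?_
      · simp [hg0 0 (by simp), hg0 1 (by simp)]
      · exact (continuous_ofReal.comp hg.continuous).continuousOn
    have := htop ⟨_, hcont⟩
    rw [hΛ] at this
    rw [← this, ← setIntegral_eq_integral_of_forall_compl_eq_zero (s := Set.Ioc 0 1)]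
    · refine setIntegral_congr_fun measurableSet_Ioc fun x hx => ?_
      simp only [ContinuousMap.coe_mk]
      rw [AddCircle.liftIoc_zero_coe_apply hx, real_smul]
    · intro x hx
      rw [hg0 x fun h => hx (Set.Ioo_subset_Ioc_self h), zero_smul]
  rw [← Measure.restrict_congr_set Ioo_ae_eq_Ioc, ae_restrict_iff' measurableSet_Ioo]
  exact hopen

theorem measurePreserving_add_int (m : ℤ) :
    MeasurePreserving (fun x : ℝ => x + m) (volume.restrict (Set.Ioc (0 : ℝ) 1))
      (volume.restrict (Set.Ioc (m : ℝ) (m + 1))) := by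
  have := (measurePreserving_add_right (volume : Measure ℝ) (m : ℝ)).restrict_preimage
    (s := Set.Ioc (m : ℝ) (m + 1)) measurableSet_Ioc
  convert this using 2
  ext x
  simp

theorem measurableEmbedding_add_int (m : ℤ) : MeasurableEmbedding (fun x : ℝ => x + m) :=
  (Homeomorph.addRight (m : ℝ)).measurableEmbedding

theorem tsum_lintegral_add_int (f : ℝ → ℝ≥0∞) :
    ∑' m : ℤ, ∫⁻ x in Set.Ioc (0 : ℝ) 1, f (x + m) = ∫⁻ x, f x := by
  rw [← setLIntegral_univ, ← iUnion_Ioc_intCast ℝ,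
    lintegral_iUnion (fun _ => measurableSet_Ioc) (Set.pairwise_disjoint_Ioc_intCast ℝ)]
  exact tsum_congr fun m => (measurePreserving_add_int m).lintegral_comp_emb
    (measurableEmbedding_add_int m) f

theorem tsum_integral_add_int {f : ℝ → ℂ} (hf : Integrable f) :
    ∑' m : ℤ, ∫ x in Set.Ioc (0 : ℝ) 1, f (x + m) = ∫ x, f x := by
  rw [← setIntegral_univ, ← iUnion_Ioc_intCast ℝ,
    integral_iUnion (fun _ => measurableSet_Ioc) (Set.pairwise_disjoint_Ioc_intCast ℝ)
      hf.integrableOn]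
  exact tsum_congr fun m => (measurePreserving_add_int m).integral_comp
    (measurableEmbedding_add_int m) f

theorem aestronglyMeasurable_add_int {f : ℝ → ℂ} (hf : Integrable f) (m : ℤ) :
    AEStronglyMeasurable (fun x : ℝ => f (x + m)) (volume.restrict (Set.Ioc (0 : ℝ) 1)) :=
  (hf.comp_add_right (m : ℝ)).aestronglyMeasurable.restrict

theorem tsum_lintegral_enorm_add_int_ne_top {f : ℝ → ℂ} (hf : Integrable f) :
    ∑' m : ℤ, ∫⁻ x in Set.Ioc (0 : ℝ) 1, ‖f (x + m)‖ₑ ≠ ⊤ := by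
  rw [tsum_lintegral_add_int (fun x => ‖f x‖ₑ)]
  exact hf.2.ne

/-- Unfolding gives `∑ₘ ∫₀¹ |f(x+m)| dx = ∫ |f| < ∞`, which bounds the integral of the
periodization. -/
theorem integrableOn_periodization {f : ℝ → ℂ} (hf : Integrable f) :
    IntegrableOn (fun x : ℝ => ∑' m : ℤ, f (x + m)) (Set.Ioc 0 1) := by
  refine ⟨(AEMeasurable.tsum fun m =>
    (aestronglyMeasurable_add_int hf m).aemeasurable).aestronglyMeasurable, ?_⟩
  refine lt_of_le_of_lt (lintegral_mono fun x => enorm_tsum_le_tsum_enorm) ?_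
  rw [lintegral_tsum fun m => (aestronglyMeasurable_add_int hf m).enorm]
  exact (tsum_lintegral_enorm_add_int_ne_top hf).lt_top

theorem integral_periodization {f : ℝ → ℂ} (hf : Integrable f) :
    ∫ x in Set.Ioc (0 : ℝ) 1, ∑' m : ℤ, f (x + m) = ∫ x, f x := by
  rw [integral_tsum (aestronglyMeasurable_add_int hf) (tsum_lintegral_enorm_add_int_ne_top hf),
    tsum_integral_add_int hf]

theorem norm_cexp_two_pi_I_mul (n : ℤ) (x : ℝ) : ‖cexp (2 * π * I * n * x)‖ = 1 := by
  have : (2 * π * I * n * x : ℂ) = ((2 * π * n * x : ℝ) : ℂ) * I := by push_cast; ring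
  rw [this, Complex.norm_exp_ofReal_mul_I]

theorem cexp_two_pi_I_mul_add_int (n m : ℤ) (x : ℝ) :
    cexp (2 * π * I * n * ((x + m : ℝ) : ℂ)) = cexp (2 * π * I * n * x) := by
  have : (2 * π * I * n * ((x + m : ℝ) : ℂ) : ℂ)
      = 2 * π * I * n * x + ((n * m : ℤ) : ℂ) * (2 * π * I) := by push_cast; ring
  rw [this, Complex.exp_add, Complex.exp_int_mul_two_pi_mul_I, mul_one]

/-- The character `exp(2πinx)` is 1-periodic, so it passes inside the periodization before
unfolding. -/
theorem integral_cexp_mul_periodization {f : ℝ → ℂ} (hf : Integrable f) (n : ℤ) :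
    ∫ x in Set.Ioc (0 : ℝ) 1, cexp (2 * π * I * n * x) * ∑' m : ℤ, f (x + m) =
      ∫ x : ℝ, cexp (2 * π * I * n * x) * f x := by
  have hi : Integrable fun x : ℝ => cexp (2 * π * I * n * x) * f x :=
    hf.bdd_mul (c := 1) (by fun_prop)
      (Filter.Eventually.of_forall fun x => (norm_cexp_two_pi_I_mul n x).le)
  rw [← integral_periodization hi]
  simp only [cexp_two_pi_I_mul_add_int, tsum_mul_left]

theorem integral_cexp_Ioc (n : ℤ) :
    ∫ x in Set.Ioc (0 : ℝ) 1, cexp (2 * π * I * n * x) = if n = 0 then 1 else 0 := by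
  rcases eq_or_ne n 0 with rfl | hn
  · simp
  rw [if_neg hn, ← intervalIntegral.integral_of_le zero_le_one, integral_exp_mul_complex]
  · have : (2 * π * I * n : ℂ) = n * (2 * π * I) := by ring
    simp [this, Complex.exp_int_mul_two_pi_mul_I]
  · simp [hn, Real.pi_ne_zero, I_ne_zero]

/-- The periodization of an integrable function is a.e. the constant `c` exactly when the
Fourier transform at the integers is `c` at `0` and vanishes elsewhere. -/
theorem periodization_ae_eq_const_iff {f : ℝ → ℂ} (hf : Integrable f) (c : ℂ) :
    (∀ᵐ x ∂(volume.restrict (Set.Icc (0 : ℝ) 1)), ∑' m : ℤ, f (x + m) = c) ↔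
      ∀ n : ℤ, ∫ x : ℝ, cexp (2 * π * I * n * x) * f x = if n = 0 then c else 0 := by
  rw [← Measure.restrict_congr_set Ioc_ae_eq_Icc]
  have hc : ∀ n : ℤ, ∫ x in Set.Ioc (0 : ℝ) 1, cexp (2 * π * I * n * x) * c =
      if n = 0 then c else 0 := fun n => by
    rw [integral_mul_const, integral_cexp_Ioc]
    split_ifs <;> simp
  constructor
  · intro h n
    rw [← integral_cexp_mul_periodization hf, ← hc n]
    refine integral_congr_ae ?_
    filter_upwards [h] with x hx
    rw [hx]
  · intro h
    have hp := integrableOn_periodization hf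
    have hci : IntegrableOn (fun _ : ℝ => c) (Set.Ioc 0 1) := integrable_const c
    have hb : ∀ (n : ℤ) (u : ℝ → ℂ), IntegrableOn u (Set.Ioc 0 1) →
        IntegrableOn (fun x : ℝ => cexp (2 * π * I * n * x) * u x) (Set.Ioc 0 1) := fun n u hu =>
      Integrable.bdd_mul (c := 1) hu (by fun_prop)
        (Filter.Eventually.of_forall fun x => (norm_cexp_two_pi_I_mul n x).le)
    have := ae_eq_zero_of_fourierCoeff_eq_zero (hp.sub hci) fun n => by
      simp only [Pi.sub_apply, mul_sub]
      rw [integral_sub (hb n _ hp) (hb n _ hci), integral_cexp_mul_periodization hf, h n, hc n,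
        sub_self]
    filter_upwards [this] with x hx
    exact sub_eq_zero.1 hx

/-- Fubini reduces this to the line: the function periodized is the marginal of `G` over the second
variable. -/
theorem periodization_fst_ae_eq_const_iff {G : ℝ × ℝ → ℂ} (hG : Integrable G) (c : ℂ) :
    (∀ᵐ x ∂(volume.restrict (Set.Icc (0 : ℝ) 1)), ∑' m : ℤ, ∫ y : ℝ, G (x + m, y) = c) ↔
      ∀ n : ℤ, ∫ p : ℝ × ℝ, cexp (2 * π * I * n * p.1) * G p = if n = 0 then c else 0 := by
  rw [Measure.volume_eq_prod] at hG
  rw [periodization_ae_eq_const_iff hG.integral_prod_left c]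
  refine forall_congr' fun n => ?_
  have hi : Integrable (fun p : ℝ × ℝ => cexp (2 * π * I * n * p.1) * G p)
      ((volume : Measure ℝ).prod volume) :=
    hG.bdd_mul (c := 1) (by fun_prop)
      (Filter.Eventually.of_forall fun p => (norm_cexp_two_pi_I_mul n p.1).le)
  rw [Measure.volume_eq_prod, integral_prod _ hi]
  simp only [integral_const_mul]

/-! ### Triangular affine changes of variables -/

/-- The affine map `(x, y) ↦ (a x + b y + s, d y + t)` of the plane. -/
def triAffine (a b d s t : ℝ) (p : ℝ × ℝ) : ℝ × ℝ := (a * p.1 + b * p.2 + s, d * p.2 + t)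

theorem continuous_triAffine (a b d s t : ℝ) : Continuous (triAffine a b d s t) := by
  unfold triAffine
  fun_prop

/-- Translations preserve the measure and the linear part is triangular with determinant `a d`. The
shear `b` serves to turn a phase in both variables into a phase in one coordinate. -/
theorem map_triAffine {a d : ℝ} (b : ℝ) (ha : a ≠ 0) (hd : d ≠ 0) (s t : ℝ) :
    Measure.map (triAffine a b d s t) volume = ENNReal.ofReal |(a * d)⁻¹| • volume := by
  let L : ℝ × ℝ →ₗ[ℝ] ℝ × ℝ :=
    LinearMap.prod (a • LinearMap.fst ℝ ℝ ℝ + b • LinearMap.snd ℝ ℝ ℝ) (d • LinearMap.snd ℝ ℝ ℝ)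
  have hdet : LinearMap.det L = a * d := by
    rw [← LinearMap.det_toMatrix (Module.Basis.finTwoProd ℝ), Matrix.det_fin_two]
    simp [LinearMap.toMatrix_apply, L]
  have hL : LinearMap.det L ≠ 0 := by rw [hdet]; exact mul_ne_zero ha hd
  have hm := Measure.map_linearMap_addHaar_eq_smul_addHaar (volume : Measure (ℝ × ℝ)) hL
  have hLc : Measurable L := (LinearMap.continuous_of_finiteDimensional L).measurable
  have hT : triAffine a b d s t = (fun p => p + (s, t)) ∘ L := by
    funext p
    simp [triAffine, L]
  rw [hT, ← Measure.map_map (measurable_add_const _) hLc, hm, Measure.map_smul, hdet,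
    map_add_right_eq_self]

theorem quasiMeasurePreserving_triAffine {a d : ℝ} (b : ℝ) (ha : a ≠ 0) (hd : d ≠ 0) (s t : ℝ) :
    Measure.QuasiMeasurePreserving (triAffine a b d s t) volume volume :=
  ⟨(continuous_triAffine a b d s t).measurable, by
    rw [map_triAffine b ha hd]
    exact Measure.smul_absolutelyContinuous⟩

theorem aestronglyMeasurable_map_triAffine {a d : ℝ} (b : ℝ) (ha : a ≠ 0) (hd : d ≠ 0) (s t : ℝ)
    {f : ℝ × ℝ → ℂ} (hf : AEStronglyMeasurable f) :
    AEStronglyMeasurable f (Measure.map (triAffine a b d s t) volume) := by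
  rw [map_triAffine b ha hd]
  exact hf.smul_measure _

theorem eLpNorm_comp_triAffine {a d : ℝ} (b : ℝ) (ha : a ≠ 0) (hd : d ≠ 0) (s t : ℝ)
    {f : ℝ × ℝ → ℂ} (hf : AEStronglyMeasurable f) :
    eLpNorm (fun p => f (triAffine a b d s t p)) 2 volume =
      ENNReal.ofReal |(a * d)⁻¹| ^ (1 / 2 : ℝ) * eLpNorm f 2 volume := by
  have := eLpNorm_map_measure (p := 2) (aestronglyMeasurable_map_triAffine b ha hd s t hf)
    (continuous_triAffine a b d s t).measurable.aemeasurable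
  rw [map_triAffine b ha hd, eLpNorm_smul_measure_of_ne_top (by norm_num)] at this
  simpa [Function.comp_def] using this.symm

theorem memLp_comp_triAffine {a d : ℝ} (b : ℝ) (ha : a ≠ 0) (hd : d ≠ 0) (s t : ℝ)
    {f : ℝ × ℝ → ℂ} (hf : MemLp f 2) : MemLp (fun p => f (triAffine a b d s t p)) 2 := by
  refine ⟨hf.1.comp_quasiMeasurePreserving (quasiMeasurePreserving_triAffine b ha hd s t), ?_⟩
  rw [eLpNorm_comp_triAffine b ha hd s t hf.1]
  exact ENNReal.mul_lt_top
    (ENNReal.rpow_lt_top_of_nonneg (by norm_num) ENNReal.ofReal_ne_top) hf.2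

theorem integrable_comp_triAffine {a d : ℝ} (b : ℝ) (ha : a ≠ 0) (hd : d ≠ 0) (s t : ℝ)
    {f : ℝ × ℝ → ℂ} (hf : Integrable f) : Integrable (fun p => f (triAffine a b d s t p)) := by
  refine Integrable.comp_measurable ?_ (continuous_triAffine a b d s t).measurable
  rw [map_triAffine b ha hd]
  exact hf.smul_measure ENNReal.ofReal_ne_top

theorem integral_comp_triAffine {a d : ℝ} (b : ℝ) (ha : a ≠ 0) (hd : d ≠ 0) (s t : ℝ)
    {f : ℝ × ℝ → ℂ} (hf : AEStronglyMeasurable f) :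
    ∫ p, f (triAffine a b d s t p) = (|(a * d)⁻¹| : ℝ) * ∫ p, f p := by
  have := integral_map (continuous_triAffine a b d s t).measurable.aemeasurable
    (aestronglyMeasurable_map_triAffine b ha hd s t hf)
  rw [map_triAffine b ha hd, integral_smul_measure, ENNReal.toReal_ofReal (abs_nonneg _),
    real_smul] at this
  exact this.symm

/-! ### Phase-weighted composition operators -/

theorem memLp_phaseComp (c : ℝ) {θ : ℝ × ℝ → ℝ} (hθ : Continuous θ) {a : ℝ} (ha : a ≠ 0) (s t : ℝ)
    {f : ℝ × ℝ → ℂ} (hf : MemLp f 2) :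
    MemLp (fun p => c * (cexp (θ p * I) * f (triAffine a 0 a s t p))) 2 :=
  (memLp_phase_mul hθ (memLp_comp_triAffine 0 ha ha s t hf)).const_mul _

theorem eLpNorm_phaseComp (c : ℝ) (θ : ℝ × ℝ → ℝ) {a : ℝ} (ha : a ≠ 0)
    (s t : ℝ) {f : ℝ × ℝ → ℂ} (hf : AEStronglyMeasurable f) :
    eLpNorm (fun p => c * (cexp (θ p * I) * f (triAffine a 0 a s t p))) 2 volume =
      ‖(c : ℂ)‖ₑ * (ENNReal.ofReal |(a * a)⁻¹| ^ (1 / 2 : ℝ) * eLpNorm f 2 volume) := by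
  rw [← eLpNorm_comp_triAffine 0 ha ha s t hf, ← eLpNorm_const_smul]
  refine eLpNorm_congr_norm_ae (Filter.Eventually.of_forall fun p => ?_)
  simp [Complex.norm_exp_ofReal_mul_I]

/-- The operator `f ↦ c exp(iθ(x, y)) f(a x + s, a y + t)` on `L²(ℝ²)`. -/
def phaseComp (c : ℝ) {θ : ℝ × ℝ → ℝ} (hθ : Continuous θ) {a : ℝ} (ha : a ≠ 0) (s t : ℝ) :
    L2Plane →L[ℂ] L2Plane :=
  LinearMap.mkContinuous
    { toFun := fun f => (memLp_phaseComp c hθ ha s t (Lp.memLp f)).toLp _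
      map_add' := fun f g => by
        rw [← MemLp.toLp_add, MemLp.toLp_eq_toLp_iff]
        filter_upwards [(quasiMeasurePreserving_triAffine 0 ha ha s t).ae (Lp.coeFn_add f g)]
          with p hp
        simp only [hp, Pi.add_apply]
        ring
      map_smul' := fun z f => by
        rw [← MemLp.toLp_const_smul, MemLp.toLp_eq_toLp_iff]
        filter_upwards [(quasiMeasurePreserving_triAffine 0 ha ha s t).ae (Lp.coeFn_smul z f)]
          with p hp
        simp only [hp, Pi.smul_apply, smul_eq_mul, RingHom.id_apply]
        ring }
    (‖(c : ℂ)‖ * |(a * a)⁻¹| ^ (1 / 2 : ℝ)) (fun f => by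
      change ‖(memLp_phaseComp c hθ ha s t (Lp.memLp f)).toLp _‖ ≤ _
      rw [Lp.norm_toLp, eLpNorm_phaseComp c θ ha s t (Lp.memLp f).1, ENNReal.toReal_mul,
        ENNReal.toReal_mul, ← Lp.norm_def, ← ENNReal.toReal_rpow,
        ENNReal.toReal_ofReal (abs_nonneg _), toReal_enorm, mul_assoc])

theorem coeFn_phaseComp (c : ℝ) {θ : ℝ × ℝ → ℝ} (hθ : Continuous θ) {a : ℝ} (ha : a ≠ 0)
    (s t : ℝ) (f : L2Plane) :
    phaseComp c hθ ha s t f =ᵐ[volume]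
      fun p => c * (cexp (θ p * I) * f (triAffine a 0 a s t p)) :=
  MemLp.coeFn_toLp (memLp_phaseComp c hθ ha s t (Lp.memLp f))

/-! ### The Weyl kernel -/

theorem kernelIntegral_congr (lam : ℝ) {f g : ℝ × ℝ → ℂ} (hg : Integrable g)
    (hfg : f =ᵐ[volume] g) : kernelIntegral lam f =ᵐ[volume] kernelIntegral lam g := by
  filter_upwards [kernelIntegral_ae_linear lam 1 0 (h := f) hg hg (by
    filter_upwards [hfg] with p hp
    simpa using hp)] with p hp
  simpa using hp

/-- Substitute `t = a x - k`; the prefactor `a` cancels `dx = dt / a`. The new variables must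
satisfy `η' - ξ' = a(η - ξ) - l` and `ξ' + η' = a(ξ + η + α)`, which determines both shifts, and the
remaining factor in the exponent makes the parameter `a⁻²`. -/
theorem kernelIntegral_phaseComp (f : ℝ × ℝ → ℂ) {a : ℝ} (ha : 0 < a) (α β k l : ℝ) (p : ℝ × ℝ) :
    kernelIntegral 1 (fun q => a * (cexp ((π * (α * q.1 + β * q.2) : ℝ) * I) *
        f (triAffine a 0 a (-k) (-l) q))) p =
      cexp ((π * (β * (p.2 - p.1) + k * (p.1 + p.2 + α) / a) : ℝ) * I) *
        kernelIntegral (a ^ 2)⁻¹ f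
          (triAffine a 0 a ((a * α + l) / 2) ((a * α - l) / 2) p) := by
  set Φ : ℝ → ℂ := fun t => f (t, a * (p.2 - p.1) - l) *
    cexp (π * I * ((a ^ 2)⁻¹ : ℝ) * t * (a * (p.1 + p.2 + α) : ℝ)) with hΦ
  have h1 : kernelIntegral (a ^ 2)⁻¹ f
      (triAffine a 0 a ((a * α + l) / 2) ((a * α - l) / 2) p) = ∫ t, Φ t := by
    simp only [kernelIntegral, triAffine, hΦ]
    congr 1
    funext t
    congr 2
    · congr 1
      ring
    · push_cast
      ring
  have h2 : ∫ x, Φ (a * x + -k) = (a⁻¹ : ℝ) * ∫ t, Φ t := by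
    have := Measure.integral_comp_mul_left (fun t => Φ (t + -k)) a
    rw [integral_add_right_eq_self Φ (-k), abs_of_pos (inv_pos.2 ha), real_smul] at this
    exact this
  have h3 : ∀ x : ℝ, (fun q : ℝ × ℝ => (a : ℂ) * (cexp ((π * (α * q.1 + β * q.2) : ℝ) * I) *
        f (triAffine a 0 a (-k) (-l) q))) (x, p.2 - p.1) *
          cexp (π * I * (1 : ℝ) * x * (p.1 + p.2)) =
      (a * cexp ((π * (β * (p.2 - p.1) + k * (p.1 + p.2 + α) / a) : ℝ) * I)) *
        Φ (a * x + -k) := fun x => by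
    simp only [hΦ, triAffine]
    have e1 : (a * x + 0 * (p.2 - p.1) + -k, a * (p.2 - p.1) + -l) =
      (a * x + -k, a * (p.2 - p.1) - l) := by
      ext <;> simp; ring
    have ha' : (a : ℂ) ≠ 0 := by exact_mod_cast ha.ne'
    have e2 : cexp ((π * (α * x + β * (p.2 - p.1)) : ℝ) * I) *
        cexp (π * I * (1 : ℝ) * x * (p.1 + p.2)) =
      cexp ((π * (β * (p.2 - p.1) + k * (p.1 + p.2 + α) / a) : ℝ) * I) *
        cexp (π * I * ((a ^ 2)⁻¹ : ℝ) * (a * x + -k : ℝ) * (a * (p.1 + p.2 + α) : ℝ)) := by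
      rw [← Complex.exp_add, ← Complex.exp_add]
      congr 1
      push_cast
      field_simp
      ring
    rw [e1]
    linear_combination (a * f (a * x + -k, a * (p.2 - p.1) - l)) * e2
  rw [h1]
  unfold kernelIntegral
  simp only [h3]
  rw [integral_const_mul, h2]
  have ha' : (a : ℂ) ≠ 0 := by exact_mod_cast ha.ne'
  push_cast
  field_simp

/-- Both sides are continuous in `f` and agree on the dense subspace `L¹ ∩ L²`, where the integral
formula applies. -/
theorem weylKernel_phaseComp {a : ℝ} (ha : 0 < a) (α β k l : ℝ) (f : L2Plane) :
    weylKernel 1 (phaseComp a (θ := fun q => π * (α * q.1 + β * q.2)) (by fun_prop)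
        ha.ne' (-k) (-l) f) =
      phaseComp 1 (θ := fun p => π * (β * (p.2 - p.1) + k * (p.1 + p.2 + α) / a)) (by fun_prop)
        ha.ne' ((a * α + l) / 2) ((a * α - l) / 2) (weylKernel (a ^ 2)⁻¹ f) := by
  have hV : Continuous fun q : ℝ × ℝ => π * (α * q.1 + β * q.2) := by fun_prop
  have hW : Continuous fun p : ℝ × ℝ => π * (β * (p.2 - p.1) + k * (p.1 + p.2 + α) / a) := by
    fun_prop
  refine congrFun (dense_integrableL2.equalizer
    (g := fun f => weylKernel 1 (phaseComp a hV ha.ne' (-k) (-l) f))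
    (h := fun f => phaseComp 1 hW ha.ne' ((a * α + l) / 2) ((a * α - l) / 2)
      (weylKernel (a ^ 2)⁻¹ f)) (by fun_prop) (by fun_prop) ?_) f
  funext g
  have hg : Integrable g.1 volume := g.2
  change weylKernel 1 (phaseComp a hV ha.ne' (-k) (-l) g.1) =
    phaseComp 1 hW ha.ne' ((a * α + l) / 2) ((a * α - l) / 2) (weylKernel (a ^ 2)⁻¹ g.1)
  have hVc := coeFn_phaseComp a hV ha.ne' (-k) (-l) g.1
  have hVi : Integrable (fun p : ℝ × ℝ => (a : ℂ) * (cexp ((π * (α * p.1 + β * p.2) : ℝ) * I) *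
      g.1 (triAffine a 0 a (-k) (-l) p))) := by
    refine Integrable.const_mul ?_ _
    refine (integrable_comp_triAffine 0 ha.ne' ha.ne' (-k) (-l) hg).bdd_mul (c := 1)
      (by fun_prop) (Filter.Eventually.of_forall fun p => ?_)
    rw [Complex.norm_exp_ofReal_mul_I]
  have hVi' := hVi.congr hVc.symm
  refine Lp.ext ?_
  have hne : (a ^ 2)⁻¹ ≠ 0 := by positivity
  filter_upwards [weylKernel_of_integrable one_ne_zero hVi', kernelIntegral_congr 1 hVi hVc,
    coeFn_phaseComp 1 hW ha.ne' ((a * α + l) / 2) ((a * α - l) / 2) (weylKernel (a ^ 2)⁻¹ g.1),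
    (quasiMeasurePreserving_triAffine 0 ha.ne' ha.ne' ((a * α + l) / 2) ((a * α - l) / 2)).ae
      (weylKernel_of_integrable hne hg)] with p h1 h2 h3 h4
  rw [h1, h2, h3, h4, kernelIntegral_phaseComp _ ha, ofReal_one, one_mul]

/-- Plancherel in the first variable and a linear substitution of determinant `-λ` scale norms by
`|λ|^(-1/2)` on `L¹ ∩ L²`. At `λ = 1` this factor is one, and density does the rest. -/
theorem norm_weylKernel_one (f : L2Plane) : ‖weylKernel 1 f‖ = ‖f‖ := by
  refine congrFun (dense_integrableL2.equalizer (g := fun f => ‖weylKernel 1 f‖)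
    (h := fun f => ‖f‖) (by fun_prop) (by fun_prop) ?_) f
  funext g
  change ‖weylKernel 1 g.1‖ = ‖g.1‖
  have h : weylKernel 1 g.1 = weylKernelOnL1 1 one_ne_zero g := by
    rw [weylKernel, dif_neg one_ne_zero]
    exact LinearMap.extendOfNorm_eq (e := integrableL2.subtype) dense_integrableL2
      ⟨_, fun x => (norm_weylKernelOnL1 1 one_ne_zero x).le⟩ g
  rw [h, norm_weylKernelOnL1]
  simp

theorem inner_weylKernel_one (f g : L2Plane) :
    inner ℂ (weylKernel 1 f) (weylKernel 1 g) = inner ℂ f g :=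
  LinearIsometry.inner_map_map ⟨(weylKernel 1).toLinearMap, norm_weylKernel_one⟩ f g

theorem inner_eq_integral_weylKernel (f g : L2Plane) :
    inner ℂ f g = ∫ p, weylKernel 1 g p * starRingEnd ℂ (weylKernel 1 f p) := by
  rw [← inner_weylKernel_one, L2.inner_def]
  simp only [RCLike.inner_apply]

/-! ### Kernels of the twisted wavelets -/

theorem coeFn_dilation (j : ℤ) (f : L2Plane) :
    dilation j f =ᵐ[volume]
      fun p => (((2 : ℝ) ^ j : ℝ) : ℂ) * f (triAffine (2 ^ j) 0 (2 ^ j) 0 0 p) := by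
  filter_upwards [MemLp.coeFn_toLp (memLp_dilate (a := (2 : ℝ) ^ j) (by positivity) f)] with p hp
  refine hp.trans ?_
  simp [triAffine]

theorem coeFn_twistedTranslation (lam : ℝ) (k l : ℤ) (f : L2Plane) :
    twistedTranslation lam k l f =ᵐ[volume] fun p =>
      cexp (((π * lam * (p.1 * l - p.2 * k) : ℝ) : ℂ) * I) * f (p - ((k : ℝ), (l : ℝ))) :=
  MemLp.coeFn_toLp _

theorem twistedTranslation_eq_phaseComp (lam : ℝ) (k l : ℤ) (f : L2Plane) :
    twistedTranslation lam k l f =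
      phaseComp 1 (θ := fun q => π * (lam * l * q.1 + -(lam * k) * q.2)) (by fun_prop)
        one_ne_zero (-k) (-l) f := by
  refine Lp.ext ?_
  filter_upwards [coeFn_twistedTranslation lam k l f, coeFn_phaseComp 1
    (θ := fun q => π * (lam * l * q.1 + -(lam * k) * q.2)) (by fun_prop)
        one_ne_zero (-k) (-l) f] with p h1 h2
  rw [h1, h2, ofReal_one, one_mul]
  congr 4
  · ring
  · ext <;> simp [triAffine] <;> ring

theorem modulation_eq_phaseComp (b : ℝ) (f : L2Plane) :
    modulation b 0 f =
      phaseComp 1 (θ := fun q => π * (2 * b * q.1 + 0 * q.2)) (by fun_prop)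
        one_ne_zero (-0) (-0) f := by
  refine Lp.ext ?_
  filter_upwards [MemLp.coeFn_toLp (memLp_phase_mul
    (θ := fun p : ℝ × ℝ => 2 * π * (b * p.1 + 0 * p.2)) (by fun_prop) (Lp.memLp f)),
    coeFn_phaseComp 1 (θ := fun q => π * (2 * b * q.1 + 0 * q.2)) (by fun_prop)
        one_ne_zero (-0) (-0) f] with p h1 h2
  rw [h2, ofReal_one, one_mul]
  refine h1.trans ?_
  congr 4
  · ring
  · ext <;> simp [triAffine]

theorem two_zpow_neg_two_mul (j : ℤ) : (2 : ℝ) ^ (-2 * j) = ((2 ^ j) ^ 2)⁻¹ := by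
  rw [neg_mul, zpow_neg, mul_comm, zpow_mul]
  norm_cast

theorem twistedWavelet_eq_phaseComp (f : L2Plane) (j k l : ℤ) :
    twistedWavelet f (j, k, l) =
      phaseComp (2 ^ j) (θ := fun q => π * (l / 2 ^ j * q.1 + -(k / 2 ^ j) * q.2)) (by fun_prop)
        (zpow_pos two_pos j).ne' (-k) (-l) f := by
  have hj : (2 : ℝ) ^ j ≠ 0 := (zpow_pos two_pos j).ne'
  refine Lp.ext ?_
  filter_upwards [coeFn_dilation j (twistedTranslation ((2 : ℝ) ^ (-2 * j)) k l f),
    (quasiMeasurePreserving_triAffine 0 hj hj 0 0).ae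
      (coeFn_twistedTranslation ((2 : ℝ) ^ (-2 * j)) k l f),
    coeFn_phaseComp (2 ^ j) (θ := fun q => π * (l / 2 ^ j * q.1 + -(k / 2 ^ j) * q.2))
      (by fun_prop) hj (-k) (-l) f] with p h1 h2 h3
  refine h1.trans ?_
  rw [h2, h3]
  congr 4
  · simp only [triAffine, two_zpow_neg_two_mul]
    congr 1
    field_simp
    ring
  · ext <;> simp [triAffine] <;> ring

/-- Here `a = 2^j`, `α = l/2^j`, `β = -k/2^j`. As `a α = l`, the two shifts are `l` and `0`; the
choice of `β` cancels the second variable from the phase. -/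
theorem weylKernel_twistedWavelet (f : L2Plane) (j k l : ℤ) :
    weylKernel 1 (twistedWavelet f (j, k, l)) =ᵐ[volume] fun p =>
      cexp ((π * (k * (2 * p.1 / 2 ^ j + l / (2 ^ j) ^ 2)) : ℝ) * I) *
        weylKernel ((2 : ℝ) ^ (-2 * j)) f (2 ^ j * p.1 + l, 2 ^ j * p.2) := by
  have hj : (0 : ℝ) < 2 ^ j := zpow_pos two_pos j
  rw [twistedWavelet_eq_phaseComp, weylKernel_phaseComp hj, two_zpow_neg_two_mul]
  filter_upwards [coeFn_phaseComp 1
    (θ := fun p => π * (-(k / 2 ^ j) * (p.2 - p.1) + k * (p.1 + p.2 + l / 2 ^ j) / 2 ^ j))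
    (by fun_prop) hj.ne' ((2 ^ j * (l / 2 ^ j) + l) / 2) ((2 ^ j * (l / 2 ^ j) - l) / 2)
    (weylKernel ((2 ^ j) ^ 2)⁻¹ f)] with p hp
  rw [hp, ofReal_one, one_mul]
  congr 4
  · field_simp
    ring
  · ext <;> simp only [triAffine] <;> field_simp <;> ring

/-- The kernel of the translate is shifted by `(λ+1)l/2` and `(λ-1)l/2`. A modulation by `(λ-1)l/2`
shifts both variables by that amount, which leaves only the shift `l` in the first. Unless `λ = 1`
or `k = 0`, the phase keeps the second variable. -/
theorem weylKernel_twistedTranslation (f : L2Plane) (lam : ℝ) (k l : ℤ) :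
    weylKernel 1 (twistedTranslation lam k l f) =ᵐ[volume] fun p =>
      cexp ((π * (k * ((1 + lam) * p.1 + (1 - lam) * p.2 + lam * l)) : ℝ) * I) *
        weylKernel 1 (modulation ((lam - 1) / 2 * l) 0 f) (p.1 + l, p.2) := by
  rw [twistedTranslation_eq_phaseComp, weylKernel_phaseComp one_pos, modulation_eq_phaseComp,
    weylKernel_phaseComp one_pos]
  simp only [one_pow, inv_one]
  filter_upwards [coeFn_phaseComp 1
    (θ := fun p => π * (-(lam * k) * (p.2 - p.1) + k * (p.1 + p.2 + lam * l) / 1))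
    (by fun_prop) one_ne_zero ((1 * (lam * l) + l) / 2) ((1 * (lam * l) - l) / 2)
    (weylKernel 1 f), (quasiMeasurePreserving_triAffine 0 one_ne_zero one_ne_zero l 0).ae
    (coeFn_phaseComp 1 (θ := fun p => π * (0 * (p.2 - p.1) +
        0 * (p.1 + p.2 + 2 * ((lam - 1) / 2 * l)) / 1))
    (by fun_prop) one_ne_zero ((1 * (2 * ((lam - 1) / 2 * l)) + 0) / 2)
      ((1 * (2 * ((lam - 1) / 2 * l)) - 0) / 2) (weylKernel 1 f))] with p hp hq
  have e : triAffine 1 0 1 l 0 p = (p.1 + l, p.2) := by simp [triAffine]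
  rw [e] at hq
  have e₁ : triAffine 1 0 1 ((1 * (lam * l) + l) / 2) ((1 * (lam * l) - l) / 2) p =
      triAffine 1 0 1 ((1 * (2 * ((lam - 1) / 2 * l)) + 0) / 2)
        ((1 * (2 * ((lam - 1) / 2 * l)) - 0) / 2) (p.1 + l, p.2) := by
    ext <;> simp only [triAffine] <;> ring
  have e₂ : π * (-(lam * k) * (p.2 - p.1) + k * (p.1 + p.2 + lam * l) / 1) =
      π * (k * ((1 + lam) * p.1 + (1 - lam) * p.2 + lam * l)) := by ring
  rw [hp, hq, e₁, e₂]
  simp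

/-! ### Gram matrices of the twisted wavelets -/

theorem integrable_mul_conj {f g : ℝ × ℝ → ℂ} (hf : MemLp f 2) (hg : MemLp g 2) :
    Integrable fun p => f p * starRingEnd ℂ (g p) :=
  hf.integrable_mul hg.star

theorem conj_cexp_ofReal_mul_I (x : ℝ) :
    starRingEnd ℂ (cexp (x * I)) = cexp (((-x : ℝ) : ℂ) * I) := by
  rw [← Complex.exp_conj, map_mul, conj_ofReal, conj_I]
  push_cast
  ring_nf

theorem inner_dilation (j : ℤ) (f g : L2Plane) :
    inner ℂ (dilation j f) (dilation j g) = inner ℂ f g := by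
  have hj : (2 : ℝ) ^ j ≠ 0 := (zpow_pos two_pos j).ne'
  have hG := integrable_mul_conj (Lp.memLp g) (Lp.memLp f)
  rw [L2.inner_def, L2.inner_def]
  simp only [RCLike.inner_apply]
  have : ∫ p, dilation j g p * starRingEnd ℂ (dilation j f p) =
      ∫ p, ((2 ^ j * 2 ^ j : ℝ) : ℂ) * (fun q => g q * starRingEnd ℂ (f q))
        (triAffine (2 ^ j) 0 (2 ^ j) 0 0 p) := by
    refine integral_congr_ae ?_
    filter_upwards [coeFn_dilation j f, coeFn_dilation j g] with p h1 h2
    rw [h1, h2, map_mul, conj_ofReal]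
    push_cast
    ring
  rw [this, integral_const_mul, integral_comp_triAffine 0 hj hj 0 0 hG.1, ← mul_assoc,
    ← ofReal_mul, abs_of_pos (by positivity), mul_inv_cancel₀ (by positivity), ofReal_one, one_mul]

/-- The integrand of `crossP`, as a function on the plane. -/
def crossIntegrand (φ : L2Plane) (j₁ j₂ l₁ l₂ : ℤ) (q : ℝ × ℝ) : ℂ :=
  weylKernel ((2 : ℝ) ^ (-2 * j₁)) φ ((2 : ℝ) ^ (j₁ + j₂) * q.1 + l₁, (2 : ℝ) ^ j₁ * q.2) *
    starRingEnd ℂ (weylKernel ((2 : ℝ) ^ (-2 * j₂)) φ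
      ((2 : ℝ) ^ (2 * j₂) * q.1 + l₂, (2 : ℝ) ^ j₂ * q.2))

theorem integrable_crossIntegrand (φ : L2Plane) (j₁ j₂ l₁ l₂ : ℤ) :
    Integrable (crossIntegrand φ j₁ j₂ l₁ l₂) := by
  have h := integrable_mul_conj
    (memLp_comp_triAffine 0 (zpow_pos (two_pos (α := ℝ)) (j₁ + j₂)).ne'
      (zpow_pos (two_pos (α := ℝ)) j₁).ne' l₁ 0 (Lp.memLp (weylKernel ((2 : ℝ) ^ (-2 * j₁)) φ)))
    (memLp_comp_triAffine 0 (zpow_pos (two_pos (α := ℝ)) (2 * j₂)).ne'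
      (zpow_pos (two_pos (α := ℝ)) j₂).ne' l₂ 0 (Lp.memLp (weylKernel ((2 : ℝ) ^ (-2 * j₂)) φ)))
  simp only [triAffine, zero_mul, add_zero] at h
  exact h

theorem inner_twistedWavelet (φ : L2Plane) (j₁ k₁ l₁ j₂ k₂ l₂ n : ℤ)
    (hn : (n : ℝ) = k₁ * 2 ^ (j₂ - j₁) - k₂) :
    inner ℂ (twistedWavelet φ (j₂, k₂, l₂)) (twistedWavelet φ (j₁, k₁, l₁)) =
      ((2 ^ j₂ : ℝ) : ℂ) *
        (cexp ((π * (k₁ * l₁ / (2 ^ j₁) ^ 2 - k₂ * l₂ / (2 ^ j₂) ^ 2) : ℝ) * I) *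
          ∫ q : ℝ × ℝ, cexp (2 * π * I * n * q.1) * crossIntegrand φ j₁ j₂ l₁ l₂ q) := by
  have h1 : (2 : ℝ) ^ j₁ ≠ 0 := (zpow_pos two_pos j₁).ne'
  have h2 : (0 : ℝ) < 2 ^ j₂ := zpow_pos two_pos j₂
  rw [inner_eq_integral_weylKernel]
  have hm := (integrable_mul_conj (Lp.memLp (weylKernel 1 (twistedWavelet φ (j₁, k₁, l₁))))
    (Lp.memLp (weylKernel 1 (twistedWavelet φ (j₂, k₂, l₂))))).1
  have hc := integral_comp_triAffine 0 h2.ne' one_ne_zero 0 0 hm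
  rw [mul_one, abs_of_pos (inv_pos.2 h2)] at hc
  have h2' : ((2 ^ j₂ : ℝ) : ℂ) ≠ 0 := ofReal_ne_zero.2 h2.ne'
  -- Stretching only the first variable, by the factor `2^j₂`, turns the phase difference into
  -- `2πnξ` with `n = k₁2^(j₂-j₁) - k₂`, an integer whenever `j₁ ≤ j₂`.
  have hI : ∫ p, weylKernel 1 (twistedWavelet φ (j₁, k₁, l₁)) p *
      starRingEnd ℂ (weylKernel 1 (twistedWavelet φ (j₂, k₂, l₂)) p) = ((2 ^ j₂ : ℝ) : ℂ) *
      ∫ p, weylKernel 1 (twistedWavelet φ (j₁, k₁, l₁)) (triAffine (2 ^ j₂) 0 1 0 0 p) *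
      starRingEnd ℂ (weylKernel 1 (twistedWavelet φ (j₂, k₂, l₂))
        (triAffine (2 ^ j₂) 0 1 0 0 p)) := by
    rw [hc, ← mul_assoc, ← ofReal_mul, mul_inv_cancel₀ h2.ne', ofReal_one, one_mul]
  rw [hI, ← integral_const_mul (cexp _)]
  congr 1
  refine integral_congr_ae ?_
  have hq := quasiMeasurePreserving_triAffine 0 h2.ne' one_ne_zero 0 0
  filter_upwards [hq.ae (weylKernel_twistedWavelet φ j₁ k₁ l₁),
    hq.ae (weylKernel_twistedWavelet φ j₂ k₂ l₂)] with p hp1 hp2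
  rw [hp1, hp2, map_mul, conj_cexp_ofReal_mul_I]
  simp only [triAffine, zero_mul, add_zero, one_mul, crossIntegrand]
  have e1 : (2 : ℝ) ^ (j₁ + j₂) * p.1 = 2 ^ j₁ * (2 ^ j₂ * p.1) := by
    rw [zpow_add₀ two_ne_zero, mul_assoc]
  have e2 : (2 : ℝ) ^ (2 * j₂) * p.1 = 2 ^ j₂ * (2 ^ j₂ * p.1) := by
    rw [two_mul, zpow_add₀ two_ne_zero, mul_assoc]
  rw [e1, e2]
  have e3 : cexp ((π * (k₁ * (2 * (2 ^ j₂ * p.1) / 2 ^ j₁ + l₁ / (2 ^ j₁) ^ 2)) : ℝ) * I) *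
      cexp (((-(π * (k₂ * (2 * (2 ^ j₂ * p.1) / 2 ^ j₂ + l₂ / (2 ^ j₂) ^ 2))) : ℝ) : ℂ) * I) =
      cexp ((π * (k₁ * l₁ / (2 ^ j₁) ^ 2 - k₂ * l₂ / (2 ^ j₂) ^ 2) : ℝ) * I) *
        cexp (2 * π * I * n * p.1) := by
    have hn' : (2 * π * I * n * p.1 : ℂ) =
        ((2 * π * (k₁ * (2 ^ j₂ / 2 ^ j₁) - k₂) * p.1 : ℝ) : ℂ) * I := by
      rw [← zpow_sub₀ two_ne_zero, ← hn]
      push_cast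
      ring
    rw [← Complex.exp_add, hn', ← Complex.exp_add, ← add_mul, ← add_mul, ← ofReal_add,
      ← ofReal_add]
    congr 3
    field_simp
    ring
  rw [mul_mul_mul_comm, e3]
  ring

theorem crossP_ae_eq_zero_iff (φ : L2Plane) {j₁ j₂ : ℤ} (hj : j₁ < j₂) (l₁ l₂ : ℤ) :
    (∀ᵐ ξ ∂(volume.restrict (Set.Icc (0 : ℝ) 1)), crossP φ j₁ j₂ l₁ l₂ ξ = 0) ↔
      ∀ k₁ k₂ : ℤ,
        inner ℂ (twistedWavelet φ (j₂, k₂, l₂)) (twistedWavelet φ (j₁, k₁, l₁)) = 0 := by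
  have h := periodization_fst_ae_eq_const_iff (integrable_crossIntegrand φ j₁ j₂ l₁ l₂) 0
  simp only [ite_self] at h
  refine Iff.trans h ?_
  obtain ⟨N, hN⟩ := Int.eq_ofNat_of_zero_le (sub_nonneg.2 hj.le)
  have hcast : ∀ k₁ k₂ : ℤ, ((k₁ * 2 ^ N - k₂ : ℤ) : ℝ) = k₁ * 2 ^ (j₂ - j₁) - k₂ := fun k₁ k₂ => by
    rw [hN]
    push_cast
    simp
  constructor
  · intro h k₁ k₂
    rw [inner_twistedWavelet φ j₁ k₁ l₁ j₂ k₂ l₂ _ (hcast k₁ k₂), h, mul_zero, mul_zero]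
  · intro h n
    -- The indices `k₁ = 0`, `k₂ = -n` already produce every Fourier coefficient; the nonzero
    -- prefactors are harmless because the target is zero.
    have := h 0 (-n)
    rw [inner_twistedWavelet φ j₁ 0 l₁ j₂ (-n) l₂ n (by simp)] at this
    simpa [Complex.exp_ne_zero, zpow_ne_zero] using this

/-- A Gram matrix given by Fourier coefficients of a periodization is a block of the identity
exactly when the periodization is constant. -/
theorem periodization_eq_const_iff_gram {G : ℝ × ℝ → ℂ} (hG : Integrable G) {A : ℝ} (hA : A ≠ 0)
    (δ : Prop) [Decidable δ] (θ : ℤ → ℤ → ℝ) (hθ : δ → ∀ k, θ k k = 0) (B : ℤ → ℤ → ℂ)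
    (hB : ∀ k₁ k₂, B k₁ k₂ = A * (cexp (θ k₁ k₂ * I) *
      ∫ p : ℝ × ℝ, cexp (2 * π * I * (k₁ - k₂ : ℤ) * p.1) * G p)) :
    (∀ᵐ ξ ∂(volume.restrict (Set.Icc (0 : ℝ) 1)),
      ∑' m : ℤ, ∫ η : ℝ, G (ξ + m, η) = if δ then ((A⁻¹ : ℝ) : ℂ) else 0) ↔
    ∀ k₁ k₂, B k₁ k₂ = if k₁ = k₂ ∧ δ then 1 else 0 := by
  have hA' : (A : ℂ) ≠ 0 := ofReal_ne_zero.2 hA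
  rw [periodization_fst_ae_eq_const_iff hG]
  constructor
  · intro h k₁ k₂
    rw [hB, h]
    by_cases hk : k₁ = k₂
    · subst hk
      by_cases hd : δ
      · simp [hd, hθ hd, hA']
      · simp [hd]
    · simp [hk, sub_eq_zero]
  · intro h n
    -- Every frequency occurs as `k₁ - k₂` with `k₂ = 0`. The phase matters only for a nonzero
    -- entry, that is for `n = 0` under `δ`, where `hθ` makes it trivial.
    have := h n 0
    rw [hB, sub_zero] at this
    by_cases hn : n = 0
    · subst hn
      by_cases hd : δ
      · rw [hθ hd] at this
        simp only [hd, ofReal_zero, zero_mul, Complex.exp_zero, one_mul, and_self, if_true] at this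
        simp only [hd, if_true]
        rw [ofReal_inv, eq_inv_of_mul_eq_one_right this]
      · simpa [hd, hA', Complex.exp_ne_zero] using this
    · simpa [hn, hA', Complex.exp_ne_zero] using this

theorem gram_scale_zero_iff (φ : L2Plane) (l₁ l₂ : ℤ) :
    (∀ᵐ ξ ∂(volume.restrict (Set.Icc (0 : ℝ) 1)),
      ∑' m : ℤ, ∫ η : ℝ, weylKernel 1 φ (ξ + m + l₁, η) *
        starRingEnd ℂ (weylKernel 1 φ (ξ + m + l₂, η)) = if l₁ = l₂ then 1 else 0) ↔
    ∀ k₁ k₂ : ℤ, inner ℂ (twistedWavelet φ (0, k₂, l₂)) (twistedWavelet φ (0, k₁, l₁)) =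
      if k₁ = k₂ ∧ l₁ = l₂ then 1 else 0 := by
  have h := periodization_eq_const_iff_gram (integrable_crossIntegrand φ 0 0 l₁ l₂)
    (A := 1) one_ne_zero (l₁ = l₂) (fun k₁ k₂ => π * (k₁ * l₁ - k₂ * l₂)) (by rintro rfl k; simp)
    (fun k₁ k₂ => inner ℂ (twistedWavelet φ (0, k₂, l₂)) (twistedWavelet φ (0, k₁, l₁)))
    (fun k₁ k₂ => by
      simpa using inner_twistedWavelet φ 0 k₁ l₁ 0 k₂ l₂ (k₁ - k₂) (by simp))
  simpa [crossIntegrand] using h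

/-- The function `S^φ_{j,l}` in the variables `(ξ + m, y)`. -/
def planeS (φ : L2Plane) (j l : ℤ) (q : ℝ × ℝ) : ℂ :=
  weylKernel 1 (modulation (((2 : ℝ) ^ (-2 * j) - 1) / 2 * l) 0 φ)
    (2 * (q.1 - q.2) / (1 + (2 : ℝ) ^ (-2 * j)) + l, 2 * q.2 / (1 - (2 : ℝ) ^ (-2 * j)))

theorem one_sub_two_zpow_ne_zero {j : ℤ} (hj : j ≠ 0) : 1 - (2 : ℝ) ^ (-2 * j) ≠ 0 := by
  rw [sub_ne_zero]
  intro h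
  have := (zpow_eq_one_iff_right₀ (a := (2 : ℝ)) (by norm_num) (by norm_num)).1 h.symm
  omega

theorem planeS_eq_comp_triAffine (φ : L2Plane) (j l : ℤ) (q : ℝ × ℝ) :
    planeS φ j l q = weylKernel 1 (modulation (((2 : ℝ) ^ (-2 * j) - 1) / 2 * l) 0 φ)
      (triAffine (2 / (1 + (2 : ℝ) ^ (-2 * j))) (-(2 / (1 + (2 : ℝ) ^ (-2 * j))))
        (2 / (1 - (2 : ℝ) ^ (-2 * j))) l 0 q) := by
  unfold planeS triAffine
  congr 2 <;> ring

theorem memLp_planeS (φ : L2Plane) {j : ℤ} (hj : j ≠ 0) (l : ℤ) : MemLp (planeS φ j l) 2 := by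
  have h : planeS φ j l = _ := funext (planeS_eq_comp_triAffine φ j l)
  rw [h]
  exact memLp_comp_triAffine _ (by positivity)
    (div_ne_zero two_ne_zero (one_sub_two_zpow_ne_zero hj)) _ _ (Lp.memLp _)

/-- Unitarity of the dilation leaves twisted translations with `λ = 2^(-2j)`. Their phase depends on
`(1+λ)ξ + (1-λ)η`; half of this form is taken as the new first coordinate and `(1-λ)η/2` as the
second. This is invertible because `λ ≠ 1`. -/
theorem inner_twistedWavelet_same_scale (φ : L2Plane) {j : ℤ} (hj : j ≠ 0) (k₁ l₁ k₂ l₂ : ℤ) :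
    inner ℂ (twistedWavelet φ (j, k₂, l₂)) (twistedWavelet φ (j, k₁, l₁)) =
      (((|1 - (2 : ℝ) ^ (-4 * j)| / 4)⁻¹ : ℝ) : ℂ) *
        (cexp ((π * (2 ^ (-2 * j) * (k₁ * l₁ - k₂ * l₂)) : ℝ) * I) *
          ∫ q : ℝ × ℝ, cexp (2 * π * I * (k₁ - k₂ : ℤ) * q.1) *
            (planeS φ j l₁ q * starRingEnd ℂ (planeS φ j l₂ q))) := by
  unfold twistedWavelet
  rw [inner_dilation, inner_eq_integral_weylKernel]
  have hsq : (2 : ℝ) ^ (-4 * j) = (2 ^ (-2 * j)) ^ 2 := by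
    rw [← zpow_natCast, ← zpow_mul]
    congr 1
    push_cast
    ring
  have hS : ∀ l q, planeS φ j l q = weylKernel 1 (modulation (((2 : ℝ) ^ (-2 * j) - 1) / 2 * l) 0 φ)
    (2 * (q.1 - q.2) / (1 + (2 : ℝ) ^ (-2 * j)) + l, 2 * q.2 / (1 - (2 : ℝ) ^ (-2 * j))) :=
    fun l q => rfl
  have hne := one_sub_two_zpow_ne_zero hj
  have hpos : (0 : ℝ) < 2 ^ (-2 * j) := zpow_pos two_pos _
  simp only [hS, hsq]
  generalize (2 : ℝ) ^ (-2 * j) = lam at hne hpos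
  have ha : 2 / (1 + lam) ≠ 0 := by positivity
  have hd : 2 / (1 - lam) ≠ 0 := div_ne_zero two_ne_zero hne
  have hadd : (1 + lam) ≠ 0 := by positivity
  -- The constant of condition (v) is the reciprocal of the absolute Jacobian of this shear.
  have hdet : |1 - lam ^ 2| / 4 = |(2 / (1 + lam) * (2 / (1 - lam)))⁻¹| := by
    have : (2 / (1 + lam) * (2 / (1 - lam)))⁻¹ = (1 - lam ^ 2) / 4 := by
      field_simp
      ring
    rw [this, abs_div]
    norm_num
  have hdet0 : |(2 / (1 + lam) * (2 / (1 - lam)))⁻¹| ≠ 0 :=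
    abs_ne_zero.2 (inv_ne_zero (mul_ne_zero ha hd))
  have hm := (integrable_mul_conj (Lp.memLp (weylKernel 1 (twistedTranslation lam k₁ l₁ φ)))
    (Lp.memLp (weylKernel 1 (twistedTranslation lam k₂ l₂ φ)))).1
  have hc := integral_comp_triAffine (-(2 / (1 + lam))) ha hd 0 0 hm
  rw [hdet, ofReal_inv, eq_inv_mul_iff_mul_eq₀ (ofReal_ne_zero.2 hdet0), ← hc,
    ← integral_const_mul]
  refine integral_congr_ae ?_
  have hq := quasiMeasurePreserving_triAffine (-(2 / (1 + lam))) ha hd 0 0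
  filter_upwards [hq.ae (weylKernel_twistedTranslation φ lam k₁ l₁),
    hq.ae (weylKernel_twistedTranslation φ lam k₂ l₂)] with p hp1 hp2
  rw [hp1, hp2, map_mul, conj_cexp_ofReal_mul_I, mul_mul_mul_comm]
  have e1 : (triAffine (2 / (1 + lam)) (-(2 / (1 + lam))) (2 / (1 - lam)) 0 0 p).1 =
      2 * (p.1 - p.2) / (1 + lam) := by
    simp only [triAffine]
    ring
  have e2 : (triAffine (2 / (1 + lam)) (-(2 / (1 + lam))) (2 / (1 - lam)) 0 0 p).2 =
      2 * p.2 / (1 - lam) := by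
    simp only [triAffine]
    ring
  rw [e1, e2, ← mul_assoc (cexp _) (cexp _)]
  congr 1
  have hn : (2 * π * I * (k₁ - k₂ : ℤ) * p.1 : ℂ) = ((2 * π * (k₁ - k₂) * p.1 : ℝ) : ℂ) * I := by
    push_cast
    ring
  rw [hn, ← Complex.exp_add, ← Complex.exp_add, ← add_mul, ← add_mul, ← ofReal_add, ← ofReal_add]
  congr 3
  field_simp
  ring

theorem gram_scale_ne_zero_iff (φ : L2Plane) {j : ℤ} (hj : j ≠ 0) (l₁ l₂ : ℤ) :
    (∀ᵐ ξ ∂(volume.restrict (Set.Icc (0 : ℝ) 1)),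
      sumQ φ j l₁ l₂ ξ = if l₁ = l₂ then ((|1 - (2 : ℝ) ^ (-4 * j)| / 4 : ℝ) : ℂ) else 0) ↔
    ∀ k₁ k₂ : ℤ, inner ℂ (twistedWavelet φ (j, k₂, l₂)) (twistedWavelet φ (j, k₁, l₁)) =
      if k₁ = k₂ ∧ l₁ = l₂ then 1 else 0 := by
  have hne : |1 - (2 : ℝ) ^ (-4 * j)| / 4 ≠ 0 := by
    have := one_sub_two_zpow_ne_zero (j := 2 * j) (by omega)
    rw [← mul_assoc] at this
    norm_num at this ⊢
    exact this
  have h := periodization_eq_const_iff_gram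
    (integrable_mul_conj (memLp_planeS φ hj l₁) (memLp_planeS φ hj l₂))
    (inv_ne_zero hne) (l₁ = l₂) (fun k₁ k₂ => π * (2 ^ (-2 * j) * (k₁ * l₁ - k₂ * l₂)))
    (by rintro rfl k; simp)
    (fun k₁ k₂ => inner ℂ (twistedWavelet φ (j, k₂, l₂)) (twistedWavelet φ (j, k₁, l₁)))
    (fun k₁ k₂ => inner_twistedWavelet_same_scale φ hj k₁ l₁ k₂ l₂)
  rw [inv_inv] at h
  exact h

/-! ### Splitting orthonormality by scales -/

theorem ofReal_tsum_integral_norm_sq (F : ℤ → ℝ → ℂ) :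
    ((∑' m : ℤ, ∫ y : ℝ, ‖F m y‖ ^ 2 : ℝ) : ℂ) =
      ∑' m : ℤ, ∫ y : ℝ, F m y * starRingEnd ℂ (F m y) := by
  -- No summability is required: if the real series diverges, so does its complex copy, and both
  -- sums default to zero.
  rw [Complex.ofReal_tsum]
  refine tsum_congr fun m => ?_
  rw [← integral_complex_ofReal]
  refine integral_congr_ae (Filter.Eventually.of_forall fun y => ?_)
  simp only [mul_conj']
  push_cast
  rfl

/-- Conjugate symmetry of the inner product reduces distinct scales to `j₁ < j₂`, the order in which
the frequencies are integers. -/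
theorem orthonormal_twistedWavelet_iff (φ : L2Plane) :
    Orthonormal ℂ (twistedWavelet φ) ↔
      (∀ j l₁ l₂ k₁ k₂ : ℤ,
        inner ℂ (twistedWavelet φ (j, k₂, l₂)) (twistedWavelet φ (j, k₁, l₁)) =
          if k₁ = k₂ ∧ l₁ = l₂ then 1 else 0) ∧
      ∀ j₁ j₂ l₁ l₂ : ℤ, j₁ < j₂ → ∀ k₁ k₂ : ℤ,
        inner ℂ (twistedWavelet φ (j₂, k₂, l₂)) (twistedWavelet φ (j₁, k₁, l₁)) = 0 := by
  rw [orthonormal_iff_ite]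
  constructor
  · intro h
    refine ⟨fun j l₁ l₂ k₁ k₂ => ?_, fun j₁ j₂ l₁ l₂ hj k₁ k₂ => ?_⟩
    · rw [h]
      simp only [Prod.mk.injEq, true_and, eq_comm]
    · rw [h, if_neg]
      intro he
      exact hj.ne' (congrArg Prod.fst he)
  · rintro ⟨h1, h2⟩ ⟨j₂, k₂, l₂⟩ ⟨j₁, k₁, l₁⟩
    rcases lt_trichotomy j₁ j₂ with hj | rfl | hj
    · rw [h2 _ _ _ _ hj, if_neg]
      intro he
      exact hj.ne' (congrArg Prod.fst he)
    · rw [h1]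
      simp only [Prod.mk.injEq, true_and, eq_comm]
    · rw [← inner_conj_symm, h2 _ _ _ _ hj, map_zero, if_neg]
      intro he
      exact hj.ne (congrArg Prod.fst he)

theorem gram_scale_zero_forall_iff (φ : L2Plane) :
    (∀ l₁ l₂ k₁ k₂ : ℤ,
      inner ℂ (twistedWavelet φ (0, k₂, l₂)) (twistedWavelet φ (0, k₁, l₁)) =
        if k₁ = k₂ ∧ l₁ = l₂ then 1 else 0) ↔
      (∀ᵐ ξ ∂(volume.restrict (Set.Icc (0 : ℝ) 1)),
        (∑' m : ℤ, ∫ η : ℝ, ‖weylKernel 1 φ (ξ + m, η)‖ ^ 2) = 1) ∧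
      (∀ l : ℤ, l ≠ 0 → ∀ᵐ ξ ∂(volume.restrict (Set.Icc (0 : ℝ) 1)),
        (∑' m : ℤ, ∫ η : ℝ, weylKernel 1 φ (ξ + m, η) *
          starRingEnd ℂ (weylKernel 1 φ (ξ + m + l, η))) = 0) := by
  have hR : ∀ ξ : ℝ, (∑' m : ℤ, ∫ η : ℝ, ‖weylKernel 1 φ (ξ + m, η)‖ ^ 2) = 1 ↔
      ∑' m : ℤ, ∫ η : ℝ, weylKernel 1 φ (ξ + m, η) *
        starRingEnd ℂ (weylKernel 1 φ (ξ + m, η)) = 1 := fun ξ => by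
    rw [← ofReal_tsum_integral_norm_sq (fun m η => weylKernel 1 φ (ξ + m, η)), ofReal_eq_one]
  simp only [← gram_scale_zero_iff, hR]
  constructor
  · intro h
    refine ⟨by simpa using h 0 0, fun l hl => ?_⟩
    simpa [hl.symm] using h 0 l
  · rintro ⟨h1, h2⟩ l₁ l₂
    have key : ∀ᵐ ξ ∂(volume.restrict (Set.Icc (0 : ℝ) 1)),
        ∑' m : ℤ, ∫ η : ℝ, weylKernel 1 φ (ξ + m, η) *
          starRingEnd ℂ (weylKernel 1 φ (ξ + m + (l₂ - l₁ : ℤ), η)) =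
            if l₁ = l₂ then 1 else 0 := by
      by_cases hl : l₁ = l₂
      · simpa [hl] using h1
      · simpa [hl] using h2 (l₂ - l₁) (sub_ne_zero.2 (Ne.symm hl))
    filter_upwards [key] with ξ hξ
    -- Shifting the summation index by `l₁` shows that only `l₂ - l₁` matters, so the one-parameter
    -- family in (ii) controls all pairs.
    rw [← hξ, ← (Equiv.addRight l₁).tsum_eq fun m : ℤ => ∫ η : ℝ, weylKernel 1 φ (ξ + m, η) *
          starRingEnd ℂ (weylKernel 1 φ (ξ + m + (l₂ - l₁ : ℤ), η))]
    refine tsum_congr fun m => ?_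
    have e1 : ξ + ((m + l₁ : ℤ) : ℝ) = ξ + m + l₁ := by push_cast; ring
    have e2 : ξ + m + l₁ + ((l₂ - l₁ : ℤ) : ℝ) = ξ + m + l₂ := by push_cast; ring
    simp only [Equiv.coe_addRight, e1, e2]

theorem gram_scale_ne_zero_forall_iff (φ : L2Plane) {j : ℤ} (hj : j ≠ 0) :
    (∀ l₁ l₂ k₁ k₂ : ℤ,
      inner ℂ (twistedWavelet φ (j, k₂, l₂)) (twistedWavelet φ (j, k₁, l₁)) =
        if k₁ = k₂ ∧ l₁ = l₂ then 1 else 0) ↔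
      (∀ l₁ l₂ : ℤ, l₁ ≠ l₂ → ∀ᵐ ξ ∂(volume.restrict (Set.Icc (0 : ℝ) 1)),
        sumQ φ j l₁ l₂ ξ = 0) ∧
      (∀ l : ℤ, ∀ᵐ ξ ∂(volume.restrict (Set.Icc (0 : ℝ) 1)),
        sumR φ j l ξ = |1 - (2 : ℝ) ^ (-4 * j)| / 4) := by
  have hR : ∀ l ξ, sumR φ j l ξ = |1 - (2 : ℝ) ^ (-4 * j)| / 4 ↔
      sumQ φ j l l ξ = ((|1 - (2 : ℝ) ^ (-4 * j)| / 4 : ℝ) : ℂ) := fun l ξ => by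
    unfold sumR sumQ
    rw [← ofReal_tsum_integral_norm_sq, ofReal_inj]
  simp only [← gram_scale_ne_zero_iff φ hj, hR]
  constructor
  · intro h
    refine ⟨fun l₁ l₂ hl => by simpa only [if_neg hl] using h l₁ l₂, fun l => ?_⟩
    simpa only [if_true] using h l l
  · rintro ⟨h1, h2⟩ l₁ l₂
    by_cases hl : l₁ = l₂
    · subst hl
      simpa only [if_true] using h2 l₁
    · simpa only [if_neg hl] using h1 l₁ l₂ hl

end TwistedWavelet
end

open MeasureTheory TwistedWavelet
theorem theorem3p2 (φ : L2Plane) :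
    Orthonormal ℂ (twistedWavelet φ) ↔
      (∀ᵐ ξ ∂(volume.restrict (Set.Icc (0 : ℝ) 1)),
        (∑' m : ℤ, ∫ η : ℝ, ‖weylKernel 1 φ (ξ + m, η)‖ ^ 2) = 1) ∧
      (∀ l : ℤ, l ≠ 0 → ∀ᵐ ξ ∂(volume.restrict (Set.Icc (0 : ℝ) 1)),
        (∑' m : ℤ, ∫ η : ℝ, weylKernel 1 φ (ξ + m, η) *
          starRingEnd ℂ (weylKernel 1 φ (ξ + m + l, η))) = 0) ∧
      (∀ j₁ j₂ l₁ l₂ : ℤ, j₁ < j₂ → ∀ᵐ ξ ∂(volume.restrict (Set.Icc (0 : ℝ) 1)),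
        crossP φ j₁ j₂ l₁ l₂ ξ = 0) ∧
      (∀ j l₁ l₂ : ℤ, j ≠ 0 → l₁ ≠ l₂ → ∀ᵐ ξ ∂(volume.restrict (Set.Icc (0 : ℝ) 1)),
        sumQ φ j l₁ l₂ ξ = 0) ∧
      (∀ j l : ℤ, j ≠ 0 → ∀ᵐ ξ ∂(volume.restrict (Set.Icc (0 : ℝ) 1)),
        sumR φ j l ξ = |1 - (2 : ℝ) ^ (-4 * j)| / 4) := by
  rw [orthonormal_twistedWavelet_iff]
  constructor
  · rintro ⟨h1, h2⟩
    obtain ⟨hi, hii⟩ := (gram_scale_zero_forall_iff φ).1 (h1 0)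
    exact ⟨hi, hii, fun j₁ j₂ l₁ l₂ hj => (crossP_ae_eq_zero_iff φ hj l₁ l₂).2 (h2 j₁ j₂ l₁ l₂ hj),
      fun j l₁ l₂ hj hl => ((gram_scale_ne_zero_forall_iff φ hj).1 (h1 j)).1 l₁ l₂ hl,
      fun j l hj => ((gram_scale_ne_zero_forall_iff φ hj).1 (h1 j)).2 l⟩
  · rintro ⟨hi, hii, hiii, hiv, hv⟩
    refine ⟨fun j => ?_, fun j₁ j₂ l₁ l₂ hj =>
      (crossP_ae_eq_zero_iff φ hj l₁ l₂).1 (hiii j₁ j₂ l₁ l₂ hj)⟩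
    -- At `j = 0` one has `λ = 1` and the shear degenerates, so this scale is governed by (i) and
    -- (ii) instead of (iv) and (v).
    by_cases hj : j = 0
    · subst hj
      exact (gram_scale_zero_forall_iff φ).2 ⟨hi, hii⟩
    · exact (gram_scale_ne_zero_forall_iff φ hj).2
        ⟨fun l₁ l₂ hl => hiv j l₁ l₂ hj hl, fun l => hv j l hj⟩
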